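/- For a partition $\lambda=(\lambda_1\ge\lambda_2\ge\dots)$ put $|\lambda|=\sum_i\lambda_i$ and $[\lambda]_a=\lambda_1+\dots+\lambda_a$, with $[\lambda]_0=0$. Write $\lambda\trianglerighteq\mu$ if $|\lambda|<|\mu|$, or if $|\lambda|=|\mu|$ and $[\lambda]_a\ge[\mu]_a$ for all $a$; write $\lambda\rhd\mu$ if moreover $\lambda\ne\mu$. For $i\ge1$ let $\lambda\pm\varepsilon_i$ be obtained from $\lambda$ by adding/removing a box in row $i$ (when the result is a partition), and let $\lambda\pm\varepsilon_0=\lambda$. **The algebra.** Let $P_r(n)$ be the partition algebra over $\mathbb Q$ with parameter $n\in\mathbb N$. Its basis consists of the set-partitions of $\{1,\dots,r,\bar1,\dots,\bar r\}$ (northern vertices $\bar k$, southern vertices $k$), and $x\cdot y$ is $n^t$ times the concatenation of $x$ above $y$, where $t$ is the number of components that consist of middle vertices only. Let $s_{k,k+1}$ be the diagram of the transposition of $k$ and $k+1$. Let $p_k$ have the blocks $\{k\},\{\bar k\}$ and $\{j,\bar j\}$ for $j\neq k$, and let $p_{k+\frac12}$ have the blocks $\{k,\bar k,k+1,\overline{k+1}\}$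 and $\{j,\bar j\}$ for $j\ne k,k+1$. Put $$e_k^{(l)}=p_{k-l+1}\cdots p_k,\qquad e_{k+\frac12}^{(l)}=p_{k-l+\frac32}\cdots p_{k+\frac12}\qquad(l\text{ factors each}),$$ $s_{l,k}=s_{l,l+1}\cdots s_{k-1,k}$ for $1\le l\le k$, $s_{l,k}=s_{k,l}^{-1}$ for $1\le k<l$, and $s_{l,k}=1$ if $l=0$ or $k=0$. For $s\le r$ view $P_s(n)$ as the subalgebra of $P_r(n)$ spanned by the diagrams in which $\{k,\bar k\}$ is a block for all $k\le r-s$. **Paths.** For $\lambda\vdash r-s$ and a partition $\nu$ with $|\nu|\le r$, let $\mathrm{Std}_s(\nu\setminus\lambda)$ be the set of paths $$\lambda=\mathsf t(0)\to\mathsf t(\tfrac12)\to\mathsf t(1)\to\dots\to\mathsf t(s)=\nu$$ with $\mathsf t(k+\frac12)=\mathsf t(k)-\varepsilon_a$ and $\mathsf t(k+1)=\mathsf t(k+\frac12)+\varepsilon_b$ for some $a,b\ge0$; the pair $(-\varepsilon_a,+\varepsilon_b)$ is called an integral step. Put $\mathrm{Std}_r(\nu)=\mathrm{Std}_r(\nu\setminus\varnothing)$,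 and let $\circ$ denote the composition of paths. Let $\mathsf t^\lambda\in\mathrm{Std}_{r-s}(\lambda)$ be the path whose integral steps are $\lambda_1$ times $(-\varepsilon_0,+\varepsilon_1)$, then $\lambda_2$ times $(-\varepsilon_0,+\varepsilon_2)$, and so on. For $s\ge1$ let $\mathrm{DR}\text{-}\mathrm{Std}_s(\nu\setminus\lambda)$ be the set of $\mathsf t\in\mathrm{Std}_s(\nu\setminus\lambda)$ that contain at least one integral step $(-\varepsilon_0,+\varepsilon_0)$ or that contain, for some $i\ge1$, more than $\lambda_i$ steps $-\varepsilon_i$. **Branching coefficients.** For a partition $\nu$ put $x_{\nu,b}=\sum_{i=0}^{\nu_b-1}s_{[\nu]_b-i,[\nu]_b}$ if $b\ge1$, and $x_{\nu,0}=1$. For $\mathsf t\in\mathrm{Std}_r(\nu)$ and a step $\mathsf t(k)=\alpha\xrightarrow{-\varepsilon_a}\mathsf t(k+\frac12)=\beta\xrightarrow{+\varepsilon_b}\mathsf t(k+1)=\gamma$ put $$u_{\alpha\to\beta}=e_{k+\frac12}^{(k-|\beta|)}s_{|\alpha|,[\alpha]_a},\qquad u_{\beta\to\gamma}=e_{k+1}^{(k+1-|\gamma|)}\,x_{\gamma,b}\,s_{[\gamma]_b,|\gamma|},$$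 $$d_{\alpha\to\beta}=e_k^{(k-|\alpha|)}\,x_{\alpha,a}\,s_{[\alpha]_a,|\alpha|},\qquad d_{\beta\to\gamma}=e_{k+\frac12}^{(k-|\beta|)}s_{|\gamma|,[\gamma]_b},$$ and let $$u_{\mathsf t}=u_{\mathsf t(r-\frac12)\to\mathsf t(r)}\cdots u_{\mathsf t(0)\to\mathsf t(\frac12)},\qquad d_{\mathsf t}=d_{\mathsf t(0)\to\mathsf t(\frac12)}\cdots d_{\mathsf t(r-\frac12)\to\mathsf t(r)}.$$ **Modules.** Let $P_r^{\rhd\nu}(n)$ be the span of all $d_{\mathsf q}u_{\mathsf t}$ with $\mathsf q,\mathsf t\in\mathrm{Std}_r(\mu)$ and $\mu\rhd\nu$, and let $$P_{r,s}^{\rhd\nu\setminus\lambda}(n)=P_r^{\rhd\nu}(n)+\mathrm{span}_{\mathbb Q}\{u_{\mathsf t}\mid\mathsf t\in\mathrm{Std}_r(\nu),\ \mathsf t(r-s)\rhd\lambda\}.$$ The skew cell module is $$\Delta_s(\nu\setminus\lambda)=\mathrm{span}_{\mathbb Q}\{u_{\mathsf t^\lambda\circ\mathsf t}+P_{r,s}^{\rhd\nu\setminus\lambda}(n)\mid\mathsf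 t\in\mathrm{Std}_s(\nu\setminus\lambda)\},$$ on which $P_s(n)$ acts by right multiplication, and its Dvir radical is $\mathsf{DR}_s(\nu\setminus\lambda)=\Delta_s(\nu\setminus\lambda)\,P_s(n)\,p_r\,P_s(n)$. **Proposition.** For every $r$ there is an $N$ such that for all $n\ge N$, all $1\le s\le r$, all $\lambda\vdash r-s$, all partitions $\nu$ with $|\nu|\le r$ and all $\mathsf t\in\mathrm{DR}\text{-}\mathrm{Std}_s(\nu\setminus\lambda)$, $$u_{\mathsf t^\lambda\circ\mathsf t}+P_{r,s}^{\rhd\nu\setminus\lambda}(n)\in\mathsf{DR}_s(\nu\setminus\lambda).$$ -/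

import Mathlib

/-! ## The partition algebra -/

/-- A partition diagram: a set-partition of the `r` northern vertices `Sum.inl i` and the `r`
southern vertices `Sum.inr i`.  The vertices numbered `k̄` and `k` (`1 ≤ k ≤ r`) are the ones
with `(i : ℕ) + 1 = k`. -/
abbrev PartitionDiagram (r : ℕ) : Type := Setoid (Fin r ⊕ Fin r)

namespace PartitionDiagram

/-- The diagram `x` placed above the diagram `y`, on three rows of vertices: northern
(`Sum.inl`), middle (`Sum.inr ∘ Sum.inl`) and southern (`Sum.inr ∘ Sum.inr`).  The southern
vertices of `x` are identified with the northern vertices of `y`. -/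
def stack {r : ℕ} (x y : PartitionDiagram r) : Setoid (Fin r ⊕ (Fin r ⊕ Fin r)) :=
  Relation.EqvGen.setoid fun v w =>
    (∃ a b, x a b ∧ v = Sum.map id Sum.inl a ∧ w = Sum.map id Sum.inl b) ∨
      (∃ a b, y a b ∧ v = Sum.inr a ∧ w = Sum.inr b)

/-- The concatenation of `x` above `y`, with the middle row removed. -/
@[reducible] def comp {r : ℕ} (x y : PartitionDiagram r) : PartitionDiagram r :=
  Setoid.comap (Sum.map id Sum.inr) (stack x y)

/-- The number of connected components of `x` above `y` consisting only of middle vertices. -/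
noncomputable def loops {r : ℕ} (x y : PartitionDiagram r) : ℕ :=
  {B ∈ (stack x y).classes | ∀ v ∈ B, ∃ i : Fin r, v = Sum.inr (Sum.inl i)}.ncard

/-- The set-partition into the blocks `{k̄, k}`. -/
@[reducible] def one (r : ℕ) : PartitionDiagram r := Setoid.ker (Sum.elim id id)

/-- The diagram with blocks `{k}`, `{k̄}` and `{j̄, j}` for `j ≠ k`. -/
@[reducible] def p (r k : ℕ) : PartitionDiagram r :=
  Setoid.ker (Sum.elim (fun i : Fin r => (i, decide ((i : ℕ) + 1 = k))) fun i => (i, false))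

/-- The diagram `p_{k + 1/2}`, with blocks `{k̄, k, (k+1)‾, k+1}` and `{j̄, j}` for
`j ≠ k, k + 1`. -/
@[reducible] def pHalf (r k : ℕ) : PartitionDiagram r :=
  Setoid.ker fun v : Fin r ⊕ Fin r =>
    if ((Sum.elim id id v : Fin r) : ℕ) + 1 = k + 1 then k
    else ((Sum.elim id id v : Fin r) : ℕ) + 1

/-- The diagram `s_{k,k+1}` of the transposition of `k` and `k + 1`, with blocks `{k̄, k+1}`,
`{(k+1)‾, k}` and `{j̄, j}` for `j ≠ k, k + 1`. -/
@[reducible] def swap (r k : ℕ) : PartitionDiagram r :=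
  Setoid.ker (Sum.elim (fun i : Fin r => Equiv.swap k (k + 1) ((i : ℕ) + 1))
    fun i => (i : ℕ) + 1)

end PartitionDiagram

/-- The partition algebra `P_r(n)` over `ℚ`: formal linear combinations of partition diagrams. -/
def PartitionAlgebra (r _n : ℕ) : Type := PartitionDiagram r →₀ ℚ

namespace PartitionAlgebra

noncomputable instance (r n : ℕ) : AddCommGroup (PartitionAlgebra r n) :=
  inferInstanceAs (AddCommGroup (PartitionDiagram r →₀ ℚ))

noncomputable instance (r n : ℕ) : Module ℚ (PartitionAlgebra r n) :=
  inferInstanceAs (Module ℚ (PartitionDiagram r →₀ ℚ))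

/-- A partition diagram as a basis element. -/
noncomputable def diag {r : ℕ} (n : ℕ) (d : PartitionDiagram r) : PartitionAlgebra r n :=
  (Finsupp.single d 1 : PartitionDiagram r →₀ ℚ)

/-- The product is the bilinear extension of `x · y = n ^ (loops x y) • (x above y)`. -/
noncomputable instance (r n : ℕ) : Mul (PartitionAlgebra r n) where
  mul x y := Finsupp.sum (x : PartitionDiagram r →₀ ℚ) fun d α =>
    Finsupp.sum (y : PartitionDiagram r →₀ ℚ) fun d' β =>
      (α * β * (n : ℚ) ^ PartitionDiagram.loops d d') • diag n (PartitionDiagram.comp d d')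

noncomputable instance (r n : ℕ) : One (PartitionAlgebra r n) where
  one := diag n (PartitionDiagram.one r)

/-- The generator `p_k`. -/
noncomputable def p (r n k : ℕ) : PartitionAlgebra r n := diag n (PartitionDiagram.p r k)

/-- The generator `p_{k + 1/2}`. -/
noncomputable def pHalf (r n k : ℕ) : PartitionAlgebra r n := diag n (PartitionDiagram.pHalf r k)

/-- The generator `s_{k,k+1}`. -/
noncomputable def swap (r n k : ℕ) : PartitionAlgebra r n := diag n (PartitionDiagram.swap r k)

/-- `e_k^{(l)} = p_{k-l+1} ⋯ p_{k-1} p_k` (`l` factors). -/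
noncomputable def e (r n k l : ℕ) : PartitionAlgebra r n :=
  ((List.range' (k - l + 1) l).map (p r n)).prod

/-- `e_{k+1/2}^{(l)} = p_{k-l+3/2} ⋯ p_{k-1/2} p_{k+1/2}` (`l` factors). -/
noncomputable def eHalf (r n k l : ℕ) : PartitionAlgebra r n :=
  ((List.range' (k - l + 1) l).map (pHalf r n)).prod

/-- `s_{l,k}`: this is `s_{l,l+1} s_{l+1,l+2} ⋯ s_{k-1,k}` for `l ≤ k`, the inverse
`s_{l-1,l} ⋯ s_{k,k+1}` of `s_{k,l}` for `k < l`, and `1` if `l = 0` or `k = 0`. -/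
noncomputable def s (r n l k : ℕ) : PartitionAlgebra r n :=
  if l = 0 ∨ k = 0 then 1
  else if l ≤ k then ((List.range' l (k - l)).map (swap r n)).prod
  else ((List.range' k (l - k)).reverse.map (swap r n)).prod

/-- The copy of `P_s(n)` inside `P_r(n)`: linear combinations of the diagrams in which `{k̄, k}` is
a block for every `k ≤ r - s`, that is, of set-partitions of the vertices
`r-s+1, …, r` and their northern counterparts. -/
noncomputable def lastStrands (r n s : ℕ) : Submodule ℚ (PartitionAlgebra r n) :=
  Submodule.span ℚ {x | ∃ d : PartitionDiagram r, x = diag n d ∧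
    ∀ i : Fin r, (i : ℕ) < r - s → ∀ v, d (Sum.inl i) v ↔ v = Sum.inl i ∨ v = Sum.inr i}

/-- `P_s(n) p_r P_s(n)`, inside `P_r(n)`. -/
noncomputable def depthIdeal (r n s : ℕ) : Submodule ℚ (PartitionAlgebra r n) :=
  Submodule.span ℚ {x | ∃ a ∈ lastStrands r n s, ∃ b ∈ lastStrands r n s, x = a * p r n r * b}

end PartitionAlgebra

/-! ## Partitions

A partition is a Young diagram.  Its rows are numbered from `1` in this development and from `0`
in `YoungDiagram.rowLen`. -/

/-- The part `λ_i` for `i ≥ 1`; the value at `i = 0` is `0`. -/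
def YoungDiagram.part (lam : YoungDiagram) : ℕ → ℕ
  | 0 => 0
  | i + 1 => lam.rowLen i

/-- `[λ]_a = λ_1 + ⋯ + λ_a`. -/
def YoungDiagram.partialSum (lam : YoungDiagram) (a : ℕ) : ℕ :=
  ∑ i ∈ Finset.range a, lam.rowLen i

/-- `ν = κ + ε_b`, equivalently `κ = ν - ε_b`: the partition `ν` is obtained from `κ` by adding a
box in row `b` if `b ≥ 1`, and `ν = κ` if `b = 0`. -/
def YoungDiagram.AddsBox (κ : YoungDiagram) (b : ℕ) (ν : YoungDiagram) : Prop :=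
  ∀ i, ν.rowLen i = κ.rowLen i + if i + 1 = b then 1 else 0

/-- The dominance order: `λ ⊵ μ` if `|λ| < |μ|`, or `|λ| = |μ|` and `[λ]_a ≥ [μ]_a` for all `a`. -/
def YoungDiagram.Dominates (lam μ : YoungDiagram) : Prop :=
  lam.card < μ.card ∨ (lam.card = μ.card ∧ ∀ a, μ.partialSum a ≤ lam.partialSum a)

/-- `λ ▷ μ`. -/
def YoungDiagram.StrictlyDominates (lam μ : YoungDiagram) : Prop :=
  lam.Dominates μ ∧ lam ≠ μ

/-! ## Standard Kronecker tableaux -/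

/-- Standard Kronecker tableaux of shape `ν \ λ` and degree `s`: paths of `s` integral steps in the
branching graph, from `λ` to `ν`.  The path `snoc t a b κ ν` is `t` followed by the integral step
`μ → κ = μ - ε_a → ν = κ + ε_b`.  (If `λ` is a vertex of level `k`, that is `|λ| ≤ k`, then all the
vertices of the path automatically satisfy the size condition of their level.) -/
inductive KroneckerTableau (lam : YoungDiagram) : ℕ → YoungDiagram → Type
  | nil : KroneckerTableau lam 0 lam
  | snoc {s : ℕ} {μ : YoungDiagram} (t : KroneckerTableau lam s μ) (a b : ℕ)
      (κ ν : YoungDiagram) (hremove : κ.AddsBox a μ) (hadd : κ.AddsBox b ν) :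
      KroneckerTableau lam (s + 1) ν

namespace KroneckerTableau

/-- The composition `t₀ ∘ t` of paths: first `t₀`, then `t`. -/
def comp {lam μ : YoungDiagram} {m : ℕ} (t₀ : KroneckerTableau lam m μ) :
    {s : ℕ} → {ν : YoungDiagram} → KroneckerTableau μ s ν → KroneckerTableau lam (m + s) ν
  | _, _, nil => t₀
  | _, _, snoc t a b κ ν hremove hadd => snoc (comp t₀ t) a b κ ν hremove hadd

/-- The list of the integral steps `(-ε_a, +ε_b)` of a path, as pairs `(a, b)`, in the order in
which they are taken. -/
def steps {lam : YoungDiagram} :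
    {s : ℕ} → {ν : YoungDiagram} → KroneckerTableau lam s ν → List (ℕ × ℕ)
  | _, _, nil => []
  | _, _, snoc t a b _ _ _ _ => steps t ++ [(a, b)]

/-- The vertex `t(m)` at the integral level `m` (counted from the start of the path), for `m` at
most the degree of `t`. -/
def vertex {lam : YoungDiagram} :
    {s : ℕ} → {ν : YoungDiagram} → KroneckerTableau lam s ν → ℕ → YoungDiagram
  | _, _, nil, _ => lam
  | s + 1, _, snoc t _ _ _ ν _ _, m => if s + 1 ≤ m then ν else vertex t m

/-- The sequence of integral steps `a(1)^{λ_1} ∘ a(2)^{λ_2} ∘ ⋯`, where `a(i) = (-ε_0, +ε_i)`. -/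
def initialSteps (lam : YoungDiagram) : List (ℕ × ℕ) :=
  (List.range (lam.colLen 0)).flatMap fun i => List.replicate (lam.rowLen i) (0, i + 1)

theorem exists_steps_eq_initialSteps (m : ℕ) : ∀ lam : YoungDiagram, lam.card = m →
    ∃ t : KroneckerTableau ⊥ m lam, t.steps = initialSteps lam := by
  induction m with
  | zero =>
    intro lam h
    have hb : lam = ⊥ := by
      apply YoungDiagram.ext
      simpa [YoungDiagram.card] using h
    subst hb
    refine ⟨nil, ?_⟩
    have : (⊥ : YoungDiagram).colLen 0 = 0 := by
      by_contra hne
      have := YoungDiagram.mem_iff_lt_colLen.2 (Nat.pos_of_ne_zero hne)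
      simp at this
    simp [steps, initialSteps, this]
  | succ m ih =>
    intro lam h
    have hpos : 0 < lam.colLen 0 := by
      obtain ⟨⟨i, j⟩, hc⟩ : lam.cells.Nonempty := by
        rw [← Finset.card_pos]
        have : lam.cells.card = m + 1 := h
        omega
      have h1 : (i, 0) ∈ lam := lam.up_left_mem le_rfl (Nat.zero_le j) hc
      have := YoungDiagram.mem_iff_lt_colLen.1 h1
      omega
    obtain ⟨i, hi⟩ : ∃ i, lam.colLen 0 = i + 1 := ⟨lam.colLen 0 - 1, by omega⟩
    have hrow : 0 < lam.rowLen i :=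
      YoungDiagram.mem_iff_lt_rowLen.1 (YoungDiagram.mem_iff_lt_colLen.2 (by omega))
    obtain ⟨j, hj⟩ : ∃ j, lam.rowLen i = j + 1 := ⟨lam.rowLen i - 1, by omega⟩
    have hmem : (i, j) ∈ lam.cells := by
      rw [YoungDiagram.mem_cells, YoungDiagram.mem_iff_lt_rowLen]
      omega
    let κ : YoungDiagram :=
      { cells := lam.cells.erase (i, j)
        isLowerSet := by
          intro c d hdc hc
          simp only [Finset.coe_erase, Set.mem_sdiff, Finset.mem_coe, Set.mem_singleton_iff]
            at hc ⊢
          refine ⟨lam.isLowerSet hdc hc.1, ?_⟩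
          rintro rfl
          apply hc.2
          obtain ⟨c1, c2⟩ := c
          obtain ⟨h1, h2⟩ := hdc
          have hcm : (c1, c2) ∈ lam := hc.1
          have h3 : c1 < lam.colLen 0 := YoungDiagram.mem_iff_lt_colLen.1
            (lam.up_left_mem le_rfl (Nat.zero_le c2) hcm)
          simp only at h1 h2
          have h4 : c1 = i := by omega
          subst h4
          have := YoungDiagram.mem_iff_lt_rowLen.1 hcm
          have h5 : c2 = j := by omega
          rw [h5] }
    have hκmem : ∀ a b, (a, b) ∈ κ ↔ (a, b) ∈ lam ∧ (a, b) ≠ (i, j) := by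
      intro a b
      change (a, b) ∈ lam.cells.erase (i, j) ↔ _
      rw [Finset.mem_erase]
      exact And.comm
    have hκrow : ∀ a, lam.rowLen a = κ.rowLen a + if a + 1 = i + 1 then 1 else 0 := by
      intro a
      have key : ∀ b, b < κ.rowLen a ↔ b < lam.rowLen a ∧ (a, b) ≠ (i, j) := by
        intro b
        rw [← YoungDiagram.mem_iff_lt_rowLen, ← YoungDiagram.mem_iff_lt_rowLen]
        exact hκmem a b
      by_cases hai : a = i
      · subst hai
        have k1 : ¬ j < κ.rowLen a := fun hlt => ((key j).1 hlt).2 rfl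
        rw [if_pos rfl]
        by_cases hj0 : j = 0
        · omega
        · have := (key (j - 1)).2 ⟨by omega, fun he => by
            have := (Prod.mk.inj he).2
            omega⟩
          omega
      · have hall : ∀ b, b < κ.rowLen a ↔ b < lam.rowLen a := by
          intro b
          rw [key b]
          simp [hai]
        have h1 := hall (κ.rowLen a)
        have h2 := hall (lam.rowLen a)
        have : a + 1 ≠ i + 1 := by omega
        simp only [this, if_false]
        omega
    have hκcard : κ.card = m := by
      change (lam.cells.erase (i, j)).card = m
      rw [Finset.card_erase_of_mem hmem]
      have : lam.cells.card = m + 1 := h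
      omega
    obtain ⟨t, ht⟩ := ih κ hκcard
    refine ⟨snoc t 0 (i + 1) κ lam (fun a => by simp) hκrow, ?_⟩
    have hκcol : κ.colLen 0 = i ∨ κ.colLen 0 = i + 1 := by
      have key : ∀ a, a < κ.colLen 0 ↔ a < lam.colLen 0 ∧ (a, 0) ≠ (i, j) := by
        intro a
        rw [← YoungDiagram.mem_iff_lt_colLen, ← YoungDiagram.mem_iff_lt_colLen]
        exact hκmem a 0
      have k1 := key i
      have k2 := key (i + 1)
      have k3 := key (i - 1)
      simp only [ne_eq, Prod.mk.injEq] at k1 k2 k3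
      by_cases hi0 : i = 0
      · omega
      · have := k3.2 ⟨by omega, by omega⟩
        omega
    have hbelow : (List.range i).flatMap
          (fun k => List.replicate (lam.rowLen k) ((0, k + 1) : ℕ × ℕ)) =
        (List.range i).flatMap
          (fun k => List.replicate (κ.rowLen k) ((0, k + 1) : ℕ × ℕ)) := by
      rw [List.flatMap_def, List.flatMap_def]
      congr 1
      apply List.map_congr_left
      intro k hk
      have hk' := List.mem_range.1 hk
      rw [hκrow k]
      simp [hk'.ne]
    have hκi : κ.rowLen i = j := by
      have := hκrow i
      simp only [if_true] at this
      omega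
    have hκsteps : initialSteps κ = (List.range (i + 1)).flatMap
        (fun k => List.replicate (κ.rowLen k) ((0, k + 1) : ℕ × ℕ)) := by
      rcases hκcol with hc | hc
      · have hz : κ.rowLen i = 0 := by
          by_contra hne
          have := YoungDiagram.mem_iff_lt_colLen.1
            (YoungDiagram.mem_iff_lt_rowLen.2 (Nat.pos_of_ne_zero hne))
          omega
        rw [initialSteps, hc, List.range_succ, List.flatMap_append]
        simp [hz]
      · rw [initialSteps, hc]
    change steps t ++ [(0, i + 1)] = _
    rw [ht, hκsteps, initialSteps, hi, List.range_succ, List.flatMap_append,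
      List.flatMap_append, hbelow]
    simp [hκi, hj, List.replicate_succ', List.append_assoc]

/-- The path `t^λ` from `∅` to `λ`, for `λ` at level `|λ|`: its sequence of integral steps is
`a(1)^{λ_1} ∘ a(2)^{λ_2} ∘ ⋯`.  (A path is determined by its sequence of steps.) -/
noncomputable def initial (lam : YoungDiagram) : KroneckerTableau ⊥ lam.card lam :=
  (exists_steps_eq_initialSteps lam.card lam rfl).choose

theorem steps_initial (lam : YoungDiagram) : (initial lam).steps = initialSteps lam :=
  (exists_steps_eq_initialSteps lam.card lam rfl).choose_spec

/-- `t` lies in `DR⁰-Std_s(ν \ λ)` : some integral step of `t` is `(-ε_0, +ε_0)`. -/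
def IsDRZero {lam ν : YoungDiagram} {s : ℕ} (t : KroneckerTableau lam s ν) : Prop :=
  1 ≤ t.steps.countP fun q => q = (0, 0)

/-- `t` lies in `DRⁱ-Std_s(ν \ λ)`, for `i ≥ 1` : more than `λ_i` steps of `t` are `-ε_i`. -/
def IsDRRow {lam ν : YoungDiagram} {s : ℕ} (i : ℕ) (t : KroneckerTableau lam s ν) : Prop :=
  lam.part i < t.steps.countP fun q => q.1 = i

/-- `t` lies in `DR-Std_s(ν \ λ)`. -/
def IsDR {lam ν : YoungDiagram} {s : ℕ} (t : KroneckerTableau lam s ν) : Prop :=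
  t.IsDRZero ∨ ∃ i, 1 ≤ i ∧ t.IsDRRow i

/-! ## The Murphy basis -/

open PartitionAlgebra

/-- `∑_{i=0}^{λ_a - 1} s_{[λ]_a - i, [λ]_a}`, read as `1` if `a = 0`. -/
noncomputable def rowSum (r n : ℕ) (lam : YoungDiagram) (a : ℕ) : PartitionAlgebra r n :=
  if a = 0 then 1
  else ∑ i ∈ Finset.range (lam.part a), s r n (lam.partialSum a - i) (lam.partialSum a)

/-- The up branching coefficient of `t(k) = μ → κ = μ - ε_a`. -/
noncomputable def uRemove (r n k : ℕ) (μ : YoungDiagram) (a : ℕ) (κ : YoungDiagram) :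
    PartitionAlgebra r n :=
  eHalf r n k (k - κ.card) * s r n μ.card (μ.partialSum a)

/-- The up branching coefficient of `κ → t(k+1) = ν = κ + ε_b`. -/
noncomputable def uAdd (r n k : ℕ) (ν : YoungDiagram) (b : ℕ) : PartitionAlgebra r n :=
  e r n (k + 1) (k + 1 - ν.card) * rowSum r n ν b * s r n (ν.partialSum b) ν.card

/-- The down branching coefficient of `t(k) = μ → μ - ε_a`. -/
noncomputable def dRemove (r n k : ℕ) (μ : YoungDiagram) (a : ℕ) : PartitionAlgebra r n :=
  e r n k (k - μ.card) * rowSum r n μ a * s r n (μ.partialSum a) μ.card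

/-- The down branching coefficient of `κ → t(k+1) = ν = κ + ε_b`. -/
noncomputable def dAdd (r n k : ℕ) (κ ν : YoungDiagram) (b : ℕ) : PartitionAlgebra r n :=
  eHalf r n k (k - κ.card) * s r n ν.card (ν.partialSum b)

/-- The element `u_t` of `P_r(n)`, for a path `t` that starts from `∅` at level `0`: the product of
the up branching coefficients of `t`, the last step leftmost. -/
noncomputable def u (r n : ℕ) :
    {k : ℕ} → {ν : YoungDiagram} → KroneckerTableau ⊥ k ν → PartitionAlgebra r n
  | _, _, nil => 1
  | k + 1, _, snoc (μ := μ) t a b κ ν _ _ => uAdd r n k ν b * uRemove r n k μ a κ * u r n t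

/-- The element `d_t` of `P_r(n)`, for a path `t` that starts from `∅` at level `0`: the product of
the down branching coefficients of `t`, the first step leftmost. -/
noncomputable def d (r n : ℕ) :
    {k : ℕ} → {ν : YoungDiagram} → KroneckerTableau ⊥ k ν → PartitionAlgebra r n
  | _, _, nil => 1
  | k + 1, _, snoc (μ := μ) t a b κ ν _ _ => d r n t * (dRemove r n k μ a * dAdd r n k κ ν b)

end KroneckerTableau

/-! ## Skew cell modules and the Dvir radical -/

namespace PartitionAlgebra

open KroneckerTableau

/-- `P_r^{▷ν}(n)`: the span of the `d_q u_t` with `q, t ∈ Std_r(μ)` and `μ ▷ ν`. -/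
noncomputable def cellIdeal (r n : ℕ) (ν : YoungDiagram) : Submodule ℚ (PartitionAlgebra r n) :=
  Submodule.span ℚ {x | ∃ μ : YoungDiagram, μ.StrictlyDominates ν ∧
    ∃ q t : KroneckerTableau ⊥ r μ, x = d r n q * u r n t}

/-- `P_{r,s}^{▷ν\λ}(n)`: the sum of `P_r^{▷ν}(n)` and of the span of the `u_t` with
`t ∈ Std_r(ν)` and `t(r - s) ▷ λ`. -/
noncomputable def skewIdeal (r n s : ℕ) (lam ν : YoungDiagram) :
    Submodule ℚ (PartitionAlgebra r n) :=
  cellIdeal r n ν ⊔ Submodule.span ℚ {x | ∃ t : KroneckerTableau ⊥ r ν,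
    (t.vertex (r - s)).StrictlyDominates lam ∧ x = u r n t}

/-- The span in `P_r(n)` of the elements `u_{t^λ ∘ t}`, for `t ∈ Std_s(ν \ λ)`.  Here
`r = |λ| + s`. -/
noncomputable def skewSpan (r n s : ℕ) (lam ν : YoungDiagram) :
    Submodule ℚ (PartitionAlgebra r n) :=
  Submodule.span ℚ {x | ∃ t : KroneckerTableau lam s ν, x = u r n ((initial lam).comp t)}

/-- The skew cell module `Δ_s(ν \ λ)`, as a subspace of `P_r(n) / P_{r,s}^{▷ν\λ}(n)`: the span of
the `u_{t^λ ∘ t} + P_{r,s}^{▷ν\λ}(n)`, for `t ∈ Std_s(ν \ λ)`. -/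
noncomputable def skewCellModule (r n s : ℕ) (lam ν : YoungDiagram) :
    Submodule ℚ (PartitionAlgebra r n ⧸ skewIdeal r n s lam ν) :=
  (skewSpan r n s lam ν).map (skewIdeal r n s lam ν).mkQ

/-- The Dvir radical `DR_s(ν \ λ) = Δ_s(ν \ λ) P_s(n) p_r P_s(n)`, where `P_s(n)` acts on the right
by `(m + P_{r,s}^{▷ν\λ}(n)) y = m y + P_{r,s}^{▷ν\λ}(n)`.  Every element of `Δ_s(ν \ λ)` has
a representative `m` in the span of the `u_{t^λ ∘ t}`, and the action is computed on
these. -/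
noncomputable def dvirRadical (r n s : ℕ) (lam ν : YoungDiagram) :
    Submodule ℚ (PartitionAlgebra r n ⧸ skewIdeal r n s lam ν) :=
  Submodule.span ℚ {z | ∃ m ∈ skewSpan r n s lam ν, ∃ y ∈ depthIdeal r n s,
    z = (skewIdeal r n s lam ν).mkQ (m * y)}

end PartitionAlgebra

/-!
The partition algebra `P_r(n)` acts on the `r`-th tensor power of an `n`-dimensional space.  In terms
of colourings of the vertices by `n` colours, a diagram acts by the matrix whose entry at a northern
colouring `f` and a southern colouring `g` is `1` if the colouring is constant on the blocks.  For
`n ≥ 2r` this action is faithful (`toMatrix_injective`), so identities in `P_r(n)` may be checked on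
matrices.  It therefore suffices to find, for every `t` in `DR-Std_s(ν \ λ)`, an element `y` of
`P_s(n) p_r P_s(n)` with `u_{t^λ ∘ t} y = u_{t^λ ∘ t}`.

If `t` has a step `(-ε_0, +ε_0)`, then the corresponding southern vertex `j` is isolated in
`u_{t^λ ∘ t}`, so that `u_{t^λ ∘ t} p_j = n u_{t^λ ∘ t}` (`exists_toMatrix_u_comp_mul`), and
`y = p_j / n` will do.

Suppose that more than `λ_i` steps of `t` are `-ε_i`.  A step `-ε_i` at time `k` joins the strand
that is removed from row `i` to the southern vertex `k + 1`.  At most `λ_i` of the strands that are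
ever in row `i` do not yet carry one of the last `s` southern vertices, so that one of the strands
removed does carry one, and two of the last `s` southern vertices become connected.  For the
matrices this says that the entries of `u_{t^λ ∘ t}` vanish at every southern colouring that is
injective on the last `s` vertices; it follows from the inequality `freshCount_add_countP_le`, proved
by induction along `t`.  The projection to the colourings that are not injective there is the matrix
of an element of `P_s(n) p_r P_s(n)`, by inclusion and exclusion over pairs of strands
(`exists_mem_depthIdeal_mul_eq`), and this element is `y`.
-/

/-! ### The action on tensor space -/

namespace PartitionDiagram

theorem stack_le_ker_iff {r : ℕ} {α : Type*} (x y : PartitionDiagram r) (f g h : Fin r → α) :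
    stack x y ≤ Setoid.ker (Sum.elim f (Sum.elim g h)) ↔
      x ≤ Setoid.ker (Sum.elim f g) ∧ y ≤ Setoid.ker (Sum.elim g h) := by
  constructor
  · intro H
    constructor
    · intro a b hab
      have := H (Relation.EqvGen.rel _ _ (Or.inl ⟨a, b, hab, rfl, rfl⟩))
      rw [Setoid.ker_def] at this ⊢
      rcases a with a | a <;> rcases b with b | b <;> simpa using this
    · intro a b hab
      have := H (Relation.EqvGen.rel _ _ (Or.inr ⟨a, b, hab, rfl, rfl⟩))
      rw [Setoid.ker_def] at this ⊢
      simpa using this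
  · rintro ⟨H1, H2⟩
    refine Setoid.eqvGen_le ?_
    rintro v w (⟨a, b, hab, rfl, rfl⟩ | ⟨a, b, hab, rfl, rfl⟩)
    · have := H1 hab
      rw [Setoid.ker_def] at this ⊢
      rcases a with a | a <;> rcases b with b | b <;> simpa using this
    · have := H2 hab
      rw [Setoid.ker_def] at this ⊢
      simpa using this

/-- The blocks of `x` above `y` that contain an outer vertex, as a set of points of the quotient. -/
def outerBlocks {r : ℕ} (x y : PartitionDiagram r) : Set (Quotient (stack x y)) :=
  Set.range fun v => Quotient.mk (stack x y) (Sum.map id Sum.inr v)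

theorem loops_eq_ncard {r : ℕ} (x y : PartitionDiagram r) :
    loops x y = (outerBlocks x y)ᶜ.ncard := by
  have hinj : Function.Injective fun q : Quotient (stack x y) =>
      {v | Quotient.mk (stack x y) v = q} := by
    intro q q' h
    obtain ⟨v, rfl⟩ := q.exists_rep
    have : v ∈ {w | Quotient.mk (stack x y) w = q'} := by
      rw [← show _ = {w | Quotient.mk (stack x y) w = q'} from h]
      rfl
    exact this
  rw [loops, ← Set.ncard_image_of_injective _ hinj]
  congr 1
  ext B
  constructor
  · rintro ⟨⟨v, rfl⟩, hB⟩
    refine ⟨Quotient.mk _ v, ?_, ?_⟩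
    · rintro ⟨w, hw⟩
      obtain ⟨i, hi⟩ := hB _ (Quotient.exact hw)
      rcases w with w | w <;> simp at hi
    · ext w
      exact Quotient.eq (r := stack x y)
  · rintro ⟨q, hq, rfl⟩
    obtain ⟨v, rfl⟩ := q.exists_rep
    refine ⟨⟨v, ?_⟩, ?_⟩
    · ext w
      exact Quotient.eq (r := stack x y)
    · intro w hw
      rcases w with w | w | w
      · exact absurd ⟨Sum.inl w, hw⟩ hq
      · exact ⟨w, rfl⟩
      · exact absurd ⟨Sum.inr w, hw⟩ hq

/-- The colourings of the middle row that extend a colouring of the outer rows: each block of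
middle vertices is coloured freely. -/
theorem card_middle_colourings {r n : ℕ} (x y : PartitionDiagram r) (f h : Fin r → Fin n)
    (H : comp x y ≤ Setoid.ker (Sum.elim f h)) :
    Nat.card {g : Fin r → Fin n // stack x y ≤ Setoid.ker (Sum.elim f (Sum.elim g h))} =
      n ^ loops x y := by
  classical
  let out : Fin r ⊕ Fin r → Quotient (stack x y) := fun v => Quotient.mk _ (Sum.map id Sum.inr v)
  let F : {g : Fin r → Fin n // stack x y ≤ Setoid.ker (Sum.elim f (Sum.elim g h))} →
      ((outerBlocks x y)ᶜ : Set _) → Fin n :=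
    fun g c => Quotient.lift (Sum.elim f (Sum.elim g.1 h)) (fun _ _ hab => g.2 hab) c.1
  have hF : Function.Bijective F := by
    constructor
    · intro g g' hg
      apply Subtype.ext
      funext i
      by_cases hi : Quotient.mk (stack x y) (Sum.inr (Sum.inl i)) ∈ outerBlocks x y
      · obtain ⟨v, hv⟩ := hi
        have h1 : Sum.elim f (Sum.elim g.1 h) (Sum.map id Sum.inr v) = g.1 i :=
          g.2 (Quotient.exact hv)
        have h2 : Sum.elim f (Sum.elim g'.1 h) (Sum.map id Sum.inr v) = g'.1 i :=
          g'.2 (Quotient.exact hv)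
        rw [← h1, ← h2]
        rcases v with v | v <;> rfl
      · exact congrFun hg ⟨_, hi⟩
    · intro φ
      let Φ : Quotient (stack x y) → Fin n := fun q =>
        if hq : q ∈ outerBlocks x y then Sum.elim f h hq.choose else φ ⟨q, hq⟩
      have hΦ : ∀ v, Φ (out v) = Sum.elim f h v := by
        intro v
        have hq : out v ∈ outerBlocks x y := ⟨v, rfl⟩
        simp only [Φ, dif_pos hq]
        have h1 : Quotient.mk (stack x y) (Sum.map id Sum.inr hq.choose) =
            Quotient.mk (stack x y) (Sum.map id Sum.inr v) := hq.choose_spec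
        have h2 : stack x y _ _ := Quotient.exact h1
        exact H h2
      have hall : ∀ w, Sum.elim f (Sum.elim
          (fun i => Φ (Quotient.mk _ (Sum.inr (Sum.inl i)))) h) w = Φ (Quotient.mk _ w) := by
        rintro (w | w | w)
        · exact (hΦ (Sum.inl w)).symm
        · rfl
        · exact (hΦ (Sum.inr w)).symm
      refine ⟨⟨fun i => Φ (Quotient.mk _ (Sum.inr (Sum.inl i))), ?_⟩, ?_⟩
      · intro a b hab
        rw [Setoid.ker_def, hall, hall]
        exact congrArg Φ (Quotient.sound hab)
      · funext ⟨c, hc⟩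
        obtain ⟨v, rfl⟩ := c.exists_rep
        change Sum.elim f (Sum.elim (fun i => Φ (Quotient.mk _ (Sum.inr (Sum.inl i)))) h) v = _
        rw [hall]
        exact dif_neg hc
  rw [Nat.card_eq_of_bijective F hF, Nat.card_fun, Nat.card_coe_set_eq, loops_eq_ncard,
    Nat.card_eq_fintype_card, Fintype.card_fin]

open Classical in
/-- The matrix by which a diagram acts on the `r`-th tensor power of an `n`-dimensional space: rows
and columns are indexed by the colourings of the northern and of the southern vertices, and the
entry is `1` if the colouring is constant on the blocks. -/
noncomputable def toMatrix {r : ℕ} (n : ℕ) (x : PartitionDiagram r) :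
    Matrix (Fin r → Fin n) (Fin r → Fin n) ℚ :=
  Matrix.of fun f g => if x ≤ Setoid.ker (Sum.elim f g) then 1 else 0

open Classical in
theorem toMatrix_apply {r n : ℕ} (x : PartitionDiagram r) (f g : Fin r → Fin n) :
    x.toMatrix n f g = if x ≤ Setoid.ker (Sum.elim f g) then 1 else 0 := rfl

theorem toMatrix_mul {r n : ℕ} (x y : PartitionDiagram r) :
    x.toMatrix n * y.toMatrix n = (n : ℚ) ^ loops x y • (comp x y).toMatrix n := by
  classical
  ext f h
  have h1 : (x.toMatrix n * y.toMatrix n) f h =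
      (Nat.card {g : Fin r → Fin n // stack x y ≤ Setoid.ker (Sum.elim f (Sum.elim g h))} : ℚ) := by
    rw [Matrix.mul_apply, Nat.card_eq_fintype_card, Fintype.card_subtype, Finset.card_filter]
    push_cast
    refine Finset.sum_congr rfl fun g _ => ?_
    rw [toMatrix_apply, toMatrix_apply, ite_zero_mul_ite_zero, mul_one]
    exact if_congr (stack_le_ker_iff x y f g h).symm rfl rfl
  rw [h1, Matrix.smul_apply, toMatrix_apply, smul_eq_mul, mul_ite, mul_one, mul_zero]
  split_ifs with H
  · rw [card_middle_colourings x y f h H, Nat.cast_pow]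
  · rw [Nat.cast_eq_zero, Nat.card_eq_zero]
    left
    refine ⟨fun ⟨g, hg⟩ => H fun a b hab => ?_⟩
    have := hg hab
    rw [Setoid.ker_def] at this ⊢
    rcases a with a | a <;> rcases b with b | b <;> exact this

end PartitionDiagram

namespace PartitionAlgebra

/-- The action of the partition algebra on tensor space. -/
noncomputable def toMatrix (r n : ℕ) :
    PartitionAlgebra r n →ₗ[ℚ] Matrix (Fin r → Fin n) (Fin r → Fin n) ℚ :=
  Finsupp.linearCombination ℚ (PartitionDiagram.toMatrix n : PartitionDiagram r → _)

variable {r n : ℕ}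

theorem toMatrix_diag (d : PartitionDiagram r) : toMatrix r n (diag n d) = d.toMatrix n := by
  refine (Finsupp.linearCombination_single ℚ 1 d).trans ?_
  rw [one_smul]

theorem toMatrix_mul (x y : PartitionAlgebra r n) :
    toMatrix r n (x * y) = toMatrix r n x * toMatrix r n y := by
  have hx : toMatrix r n x =
      Finsupp.sum (x : PartitionDiagram r →₀ ℚ) fun d α => α • d.toMatrix n := rfl
  have hy : toMatrix r n y =
      Finsupp.sum (y : PartitionDiagram r →₀ ℚ) fun d α => α • d.toMatrix n := rfl
  have hxy : x * y = Finsupp.sum (x : PartitionDiagram r →₀ ℚ) fun d α =>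
    Finsupp.sum (y : PartitionDiagram r →₀ ℚ) fun d' β =>
      (α * β * (n : ℚ) ^ PartitionDiagram.loops d d') • diag n (PartitionDiagram.comp d d') := rfl
  rw [hxy, hx, hy]
  simp only [Finsupp.sum, map_sum, map_smul, toMatrix_diag, Finset.sum_mul, Finset.mul_sum,
    Matrix.smul_mul, Matrix.mul_smul, PartitionDiagram.toMatrix_mul, smul_smul]
  rw [Finset.sum_comm]
  refine Finset.sum_congr rfl fun d _ => Finset.sum_congr rfl fun d' _ => ?_
  congr 1
  ring

theorem toMatrix_one : toMatrix r n 1 = 1 := by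
  classical
  refine (toMatrix_diag (PartitionDiagram.one r)).trans ?_
  ext f g
  rw [PartitionDiagram.toMatrix_apply, Matrix.one_apply]
  refine if_congr ⟨fun H => funext fun i => ?_, ?_⟩ rfl rfl
  · exact H (x := Sum.inl i) (y := Sum.inr i) rfl
  · rintro rfl (a | a) (b | b) hab <;>
      · have : a = b := hab
        subst this
        rfl

theorem toMatrix_list_prod (L : List (PartitionAlgebra r n)) :
    toMatrix r n L.prod = (L.map (toMatrix r n)).prod := by
  induction L with
  | nil => exact toMatrix_one
  | cons a L ih => rw [List.prod_cons, toMatrix_mul, ih, List.map_cons, List.prod_cons]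

/-- With at least `2r` colours the blocks of every diagram can be told apart by a colouring, and the
action on tensor space is faithful. -/
theorem toMatrix_injective (hn : 2 * r ≤ n) : Function.Injective (toMatrix r n) := by
  classical
  rw [injective_iff_map_eq_zero]
  intro x hx
  by_contra hne
  let x' : PartitionDiagram r →₀ ℚ := x
  have hs : x'.support.Nonempty := Finsupp.support_nonempty_iff.2 hne
  obtain ⟨d, hd⟩ := Finset.exists_minimal hs
  have hcard : Fintype.card (Quotient d) ≤ Fintype.card (Fin n) := by
    refine (Fintype.card_quotient_le d).trans ?_
    rw [Fintype.card_sum, Fintype.card_fin, Fintype.card_fin]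
    omega
  obtain ⟨φ⟩ := Function.Embedding.nonempty_of_card_le hcard
  let c : Fin r ⊕ Fin r → Fin n := fun v => φ (Quotient.mk d v)
  have hc : ∀ d' : PartitionDiagram r,
      d' ≤ Setoid.ker (Sum.elim (c ∘ Sum.inl) (c ∘ Sum.inr)) ↔ d' ≤ d := by
    intro d'
    rw [Sum.elim_comp_inl_inr]
    refine ⟨fun H a b hab => Quotient.exact (φ.injective (H hab)), fun H a b hab => ?_⟩
    exact congrArg φ (Quotient.sound (H hab))
  have h1 : toMatrix r n x = ∑ d ∈ x'.support, x' d • d.toMatrix n := rfl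
  have h2 := congrFun (congrFun (h1.symm.trans hx) (c ∘ Sum.inl)) (c ∘ Sum.inr)
  rw [Matrix.sum_apply, Finset.sum_eq_single d] at h2
  · rw [Matrix.smul_apply, PartitionDiagram.toMatrix_apply, if_pos ((hc d).2 le_rfl), smul_eq_mul,
      mul_one] at h2
    exact (Finsupp.mem_support_iff.1 hd.1) h2
  · intro d' hd' hdd
    rw [Matrix.smul_apply, PartitionDiagram.toMatrix_apply, if_neg, smul_zero]
    rw [hc]
    exact fun hle => hdd (le_antisymm hle (hd.2 hd' hle))
  · exact fun h => absurd hd.1 h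

end PartitionAlgebra

/-! ### The matrices of the generators -/

section Matrices

variable {r n : ℕ}

open Classical in
/-- The matrix of the product of the `p_k` over the strands in `T`: its entry at `(f, g)` is `1` if
the colourings `f` and `g` agree outside `T`. -/
noncomputable def cutMatrix (n : ℕ) (T : Set (Fin r)) :
    Matrix (Fin r → Fin n) (Fin r → Fin n) ℚ :=
  Matrix.of fun f g => if Set.EqOn f g Tᶜ then 1 else 0

open Classical in
theorem cutMatrix_apply (T : Set (Fin r)) (f g : Fin r → Fin n) :
    cutMatrix n T f g = if Set.EqOn f g Tᶜ then 1 else 0 := rfl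

/-- The colouring `f` takes a single value on `T`. -/
def IsConstantOn (f : Fin r → Fin n) (T : Set (Fin r)) : Prop :=
  ∀ i ∈ T, ∀ j ∈ T, f i = f j

open Classical in
/-- The matrix of the diagram that merges the strands in `T`. -/
noncomputable def mergeMatrix (n : ℕ) (T : Set (Fin r)) :
    Matrix (Fin r → Fin n) (Fin r → Fin n) ℚ :=
  Matrix.diagonal fun f => if IsConstantOn f T then 1 else 0

theorem cutMatrix_empty : cutMatrix n (∅ : Set (Fin r)) = 1 := by
  classical
  ext f g
  rw [cutMatrix_apply, Matrix.one_apply, Set.compl_empty]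
  exact if_congr (Set.eqOn_univ f g) rfl rfl

theorem cutMatrix_singleton_mul {i : Fin r} {T : Set (Fin r)} (hi : i ∉ T) :
    cutMatrix n {i} * cutMatrix n T = cutMatrix n (insert i T) := by
  classical
  ext f h
  rw [Matrix.mul_apply, Finset.sum_eq_single (Function.update f i (h i))]
  · rw [cutMatrix_apply, cutMatrix_apply, cutMatrix_apply, if_pos, one_mul]
    · refine if_congr ⟨fun H j hj => ?_, fun H j hj => ?_⟩ rfl rfl
      · have hji : j ≠ i := fun e => hj (Or.inl e)
        have := H (x := j) fun h' => hj (Or.inr h')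
        rwa [Function.update_of_ne hji] at this
      · by_cases hji : j = i
        · subst hji
          rw [Function.update_self]
        · rw [Function.update_of_ne hji]
          exact H fun h' => h'.elim hji hj
    · intro j hj
      rw [Function.update_of_ne hj]
  · intro g _ hg
    rw [cutMatrix_apply, cutMatrix_apply, ite_zero_mul_ite_zero, if_neg]
    rintro ⟨h1, h2⟩
    apply hg
    funext j
    by_cases hji : j = i
    · subst hji
      rw [Function.update_self]
      exact h2 hi
    · rw [Function.update_of_ne hji]
      exact (h1 hji).symm
  · exact fun h => absurd (Finset.mem_univ _) h

/-- Cutting a strand of `T` twice closes a loop. -/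
theorem cutMatrix_mul_singleton {i : Fin r} {T : Set (Fin r)} (hi : i ∈ T) :
    cutMatrix n T * cutMatrix n {i} = (n : ℚ) • cutMatrix n T := by
  classical
  ext f h
  have hset : ∀ g : Fin r → Fin n, Set.EqOn g h {i}ᶜ ↔
      g ∈ Finset.univ.image (Function.update h i) := by
    intro g
    simp only [Finset.mem_image, Finset.mem_univ, true_and]
    constructor
    · refine fun H => ⟨g i, funext fun j => ?_⟩
      by_cases hji : j = i
      · subst hji
        rw [Function.update_self]
      · rw [Function.update_of_ne hji]
        exact (H hji).symm
    · rintro ⟨c, rfl⟩ j hj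
      rw [Function.update_of_ne hj]
  have hT : ∀ c, cutMatrix n T f (Function.update h i c) = cutMatrix n T f h := by
    intro c
    rw [cutMatrix_apply, cutMatrix_apply]
    refine if_congr ?_ rfl rfl
    refine forall₂_congr fun j hj => ?_
    rw [Function.update_of_ne]
    rintro rfl
    exact hj hi
  simp only [Matrix.mul_apply, cutMatrix_apply {i}, mul_ite, mul_one, mul_zero, hset]
  rw [← Finset.sum_filter, Finset.filter_mem_eq_inter, Finset.univ_inter,
    Finset.sum_image (Function.update_injective h i).injOn]
  simp only [hT, Finset.sum_const, Finset.card_univ, Fintype.card_fin, Matrix.smul_apply,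
    nsmul_eq_mul, smul_eq_mul]

/-- If the strands in `T` are cut, merged with the strand `i` and cut again together with `i`, then
the merging has no effect. -/
theorem cutMatrix_mul_mergeMatrix_mul {i : Fin r} {T : Set (Fin r)} (hi : i ∉ T) :
    cutMatrix n (insert i T) * mergeMatrix n (insert i T) * cutMatrix n T =
      cutMatrix n (insert i T) := by
  classical
  ext f h
  rw [Matrix.mul_apply, mergeMatrix]
  simp only [Matrix.mul_diagonal, cutMatrix_apply, ite_zero_mul_ite_zero, mul_one]
  rw [Finset.sum_eq_single fun j => if j ∈ insert i T then h i else h j]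
  · refine if_congr ⟨fun H j hj => ?_, fun H => ⟨⟨fun j hj => ?_, fun j hj k hk => ?_⟩,
      fun j hj => ?_⟩⟩ rfl rfl
    · exact (H.1.1 hj).trans (if_neg hj)
    · exact (H hj).trans (if_neg hj).symm
    · exact (if_pos hj).trans (if_pos hk).symm
    · by_cases hji : j = i
      · subst hji
        exact if_pos (Or.inl rfl)
      · exact if_neg fun h' => h'.elim hji hj
  · intro g _ hg
    refine if_neg ?_
    rintro ⟨⟨-, h2⟩, h3⟩
    apply hg
    funext j
    split_ifs with hj
    · rw [h2 j hj i (Or.inl rfl)]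
      exact h3 hi
    · exact h3 fun h' => hj (Or.inr h')
  · exact fun h => absurd (Finset.mem_univ _) h

/-- The matrices that act on the strands below `k` only: those that commute with cutting a
strand `i ≥ k` and with the projection to a colour of such a strand. -/
noncomputable def localMatrices (r n k : ℕ) :
    Subalgebra ℚ (Matrix (Fin r → Fin n) (Fin r → Fin n) ℚ) :=
  Subalgebra.centralizer ℚ {X | ∃ i : Fin r, k ≤ i ∧ (X = cutMatrix n {i} ∨
    ∃ c, X = Matrix.diagonal fun f => if f i = c then 1 else 0)}

theorem localMatrices_mono {k l : ℕ} (h : k ≤ l) : localMatrices r n k ≤ localMatrices r n l :=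
  Subalgebra.centralizer_le ℚ _ _ fun _ ⟨i, hi, hX⟩ => ⟨i, h.trans hi, hX⟩

theorem cutMatrix_mul_comm_of_mem_localMatrices {k : ℕ}
    {X : Matrix (Fin r → Fin n) (Fin r → Fin n) ℚ} (hX : X ∈ localMatrices r n k) {i : Fin r}
    (hi : k ≤ i) : cutMatrix n {i} * X = X * cutMatrix n {i} :=
  Subalgebra.mem_centralizer_iff ℚ |>.1 hX _ ⟨i, hi, Or.inl rfl⟩

theorem eq_of_mem_localMatrices {k : ℕ} {X : Matrix (Fin r → Fin n) (Fin r → Fin n) ℚ}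
    (hX : X ∈ localMatrices r n k) {f g : Fin r → Fin n} (hfg : X f g ≠ 0) {i : Fin r}
    (hi : k ≤ i) : f i = g i := by
  have := Subalgebra.mem_centralizer_iff ℚ |>.1 hX _ ⟨i, hi, Or.inr ⟨f i, rfl⟩⟩
  have := congrFun (congrFun this f) g
  rw [Matrix.diagonal_mul, Matrix.mul_diagonal, if_pos rfl, one_mul] at this
  by_contra hne
  rw [if_neg (Ne.symm hne), mul_zero] at this
  exact hfg this

end Matrices

namespace PartitionDiagram

variable {r n : ℕ}

/-- The vertices `ī` and `i` form a block of `d`. -/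
def IsStraight (d : PartitionDiagram r) (i : Fin r) : Prop :=
  ∀ v, d (Sum.inl i) v ↔ v = Sum.inl i ∨ v = Sum.inr i

/-- The common colour of the block `{ī, i}` can be changed freely. -/
theorem IsStraight.le_ker {d : PartitionDiagram r} {i : Fin r} (hd : d.IsStraight i)
    {f g f' g' : Fin r → Fin n} (H : d ≤ Setoid.ker (Sum.elim f g)) (hf : Set.EqOn f f' {i}ᶜ)
    (hg : Set.EqOn g g' {i}ᶜ) (hi : f' i = g' i) : d ≤ Setoid.ker (Sum.elim f' g') := by
  have key : ∀ v, d (Sum.inl i) v → Sum.elim f' g' v = f' i := by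
    intro v hv
    rcases (hd v).1 hv with rfl | rfl
    · rfl
    · exact hi.symm
  have off : ∀ v, ¬ d (Sum.inl i) v → Sum.elim f g v = Sum.elim f' g' v := by
    rintro (v | v) hv
    · refine hf ?_
      rintro rfl
      exact hv (d.refl _)
    · refine hg ?_
      rintro rfl
      exact hv ((hd _).2 (Or.inr rfl))
  intro a b hab
  rw [Setoid.ker_def]
  by_cases ha : d (Sum.inl i) a
  · rw [key a ha, key b (d.trans ha hab)]
  · rw [← off a ha, ← off b fun hb => ha (d.trans hb (d.symm hab))]
    exact H hab

theorem IsStraight.cutMatrix_mul_comm {d : PartitionDiagram r} {i : Fin r} (hd : d.IsStraight i) :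
    cutMatrix n {i} * d.toMatrix n = d.toMatrix n * cutMatrix n {i} := by
  classical
  have hdi : ∀ {f g : Fin r → Fin n}, d ≤ Setoid.ker (Sum.elim f g) → f i = g i := fun H =>
    H (x := Sum.inl i) (y := Sum.inr i) ((hd _).2 (Or.inr rfl))
  ext f g
  rw [Matrix.mul_apply, Matrix.mul_apply, Finset.sum_eq_single (Function.update f i (g i)),
    Finset.sum_eq_single (Function.update g i (f i))]
  · simp only [cutMatrix_apply, toMatrix_apply, ite_zero_mul_ite_zero, mul_one]
    have h1 : Set.EqOn f (Function.update f i (g i)) {i}ᶜ := fun j hj => by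
      rw [Function.update_of_ne hj]
    have h2 : Set.EqOn (Function.update g i (f i)) g {i}ᶜ := fun j hj => by
      rw [Function.update_of_ne hj]
    refine if_congr ?_ rfl rfl
    rw [and_iff_right h1, and_iff_left h2]
    exact ⟨fun H => hd.le_ker H h1.symm h2.symm (by rw [Function.update_self]),
      fun H => hd.le_ker H h1 h2 (by rw [Function.update_self])⟩
  · intro g' _ hg'
    rw [cutMatrix_apply, toMatrix_apply, ite_zero_mul_ite_zero, if_neg]
    rintro ⟨h1, h2⟩
    apply hg'
    funext j
    by_cases hji : j = i
    · subst hji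
      rw [Function.update_self, hdi h1]
    · rw [Function.update_of_ne hji]
      exact h2 hji
  · exact fun h => absurd (Finset.mem_univ _) h
  · intro g' _ hg'
    rw [cutMatrix_apply, toMatrix_apply, ite_zero_mul_ite_zero, if_neg]
    rintro ⟨h1, h2⟩
    apply hg'
    funext j
    by_cases hji : j = i
    · subst hji
      rw [Function.update_self, hdi h2]
    · rw [Function.update_of_ne hji]
      exact (h1 hji).symm
  · exact fun h => absurd (Finset.mem_univ _) h

theorem toMatrix_mem_localMatrices {d : PartitionDiagram r} {k : ℕ}
    (hd : ∀ i : Fin r, k ≤ i → d.IsStraight i) : d.toMatrix n ∈ localMatrices r n k := by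
  classical
  rw [localMatrices, Subalgebra.mem_centralizer_iff]
  rintro X ⟨i, hi, rfl | ⟨c, rfl⟩⟩
  · exact (hd i hi).cutMatrix_mul_comm
  · ext f g
    rw [Matrix.diagonal_mul, Matrix.mul_diagonal, toMatrix_apply]
    by_cases h : d ≤ Setoid.ker (Sum.elim f g)
    · have : f i = g i := h (x := Sum.inl i) (y := Sum.inr i) ((hd i hi _).2 (Or.inr rfl))
      rw [this, mul_comm]
    · rw [if_neg h, mul_zero, zero_mul]

theorem isStraight_p {k : ℕ} {i : Fin r} (hi : (i : ℕ) + 1 ≠ k) : (p r k).IsStraight i := by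
  rintro (v | v)
  · simp only [Setoid.ker_def, Sum.elim_inl, Prod.mk.injEq, Sum.inl.injEq, reduceCtorEq, or_false]
    exact ⟨fun h => h.1.symm, fun h => by rw [h]; exact ⟨rfl, rfl⟩⟩
  · simp only [Setoid.ker_def, Sum.elim_inl, Sum.elim_inr, Prod.mk.injEq, hi, decide_false,
      and_true, Sum.inr.injEq, reduceCtorEq, false_or]
    exact eq_comm

theorem pHalf_iff {k : ℕ} {v w : Fin r ⊕ Fin r} : pHalf r k v w ↔
    (Sum.elim id id v : Fin r) = Sum.elim id id w ∨
      ((Sum.elim id id v : Fin r) : ℕ) + 1 = k ∧ ((Sum.elim id id w : Fin r) : ℕ) = k ∨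
        ((Sum.elim id id v : Fin r) : ℕ) = k ∧ ((Sum.elim id id w : Fin r) : ℕ) + 1 = k := by
  rw [Setoid.ker_def]
  generalize (Sum.elim id id v : Fin r) = i
  generalize (Sum.elim id id w : Fin r) = j
  rw [Fin.ext_iff]
  split_ifs <;> omega

theorem isStraight_pHalf {k : ℕ} {i : Fin r} (hi : k + 1 ≤ i) : (pHalf r k).IsStraight i := by
  rintro (v | v) <;>
  · simp only [pHalf_iff, Sum.elim_inl, Sum.elim_inr, id_eq, Sum.inl.injEq, Sum.inr.injEq,
      reduceCtorEq, or_false, false_or, Fin.ext_iff]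
    omega

theorem isStraight_swap {k : ℕ} {i : Fin r} (hi : k + 1 ≤ i) : (swap r k).IsStraight i := by
  have h1 : Equiv.swap k (k + 1) ((i : ℕ) + 1) = i + 1 :=
    Equiv.swap_apply_of_ne_of_ne (by omega) (by omega)
  rintro (v | v)
  · simp only [Setoid.ker_def, Sum.elim_inl, Sum.inl.injEq, reduceCtorEq, or_false, Fin.ext_iff,
      (Equiv.swap k (k + 1)).injective.eq_iff]
    omega
  · simp only [Setoid.ker_def, Sum.elim_inl, Sum.elim_inr, h1, Sum.inr.injEq, reduceCtorEq,
      false_or, Fin.ext_iff]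
    omega

theorem toMatrix_p (j : Fin r) : (p r (j + 1)).toMatrix n = cutMatrix n {j} := by
  classical
  ext f g
  rw [toMatrix_apply, cutMatrix_apply]
  refine if_congr ⟨fun H i hi => ?_, fun H => ?_⟩ rfl rfl
  · refine H (x := Sum.inl i) (y := Sum.inr i) ?_
    have : (i : ℕ) ≠ j := fun h => hi (Fin.ext h)
    simp [this]
  · rintro (a | a) (b | b) hab <;>
      simp only [Setoid.ker_def, Sum.elim_inl, Sum.elim_inr, Prod.mk.injEq, and_true] at hab ⊢
    · rw [hab.1]
    · rw [← hab.1]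
      exact H fun h => by simp [Set.mem_singleton_iff.1 h] at hab
    · rw [hab.1]
      refine (H fun h => ?_).symm
      simp [Set.mem_singleton_iff.1 h] at hab
    · rw [hab]

end PartitionDiagram

namespace PartitionAlgebra

variable {r n : ℕ}

theorem mergeMatrix_singleton (i : Fin r) : mergeMatrix n {i} = 1 := by
  classical
  rw [mergeMatrix, ← Matrix.diagonal_one]
  congr 1
  funext f
  refine if_pos fun j hj k hk => ?_
  rw [Set.mem_singleton_iff.1 hj, Set.mem_singleton_iff.1 hk]

theorem mergeMatrix_mul {S T : Set (Fin r)} {i : Fin r} (hS : i ∈ S) (hT : i ∈ T) :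
    mergeMatrix n S * mergeMatrix n T = mergeMatrix n (S ∪ T) := by
  classical
  rw [mergeMatrix, mergeMatrix, mergeMatrix, Matrix.diagonal_mul_diagonal]
  congr 1
  funext f
  rw [ite_zero_mul_ite_zero, mul_one]
  refine if_congr ⟨fun ⟨h1, h2⟩ => ?_, fun h => ⟨fun j hj k hk => h j (Or.inl hj) k (Or.inl hk),
    fun j hj k hk => h j (Or.inr hj) k (Or.inr hk)⟩⟩ rfl rfl
  have h3 : ∀ j ∈ S ∪ T, f j = f i := fun j hj =>
    hj.elim (fun h => h1 j h i hS) fun h => h2 j h i hT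
  exact fun j hj k hk => (h3 j hj).trans (h3 k hk).symm

theorem toMatrix_p (j : Fin r) : toMatrix r n (p r n (j + 1)) = cutMatrix n {j} :=
  (toMatrix_diag _).trans (PartitionDiagram.toMatrix_p j)

theorem toMatrix_pHalf {i j : Fin r} (hij : (j : ℕ) = i + 1) :
    toMatrix r n (pHalf r n (i + 1)) = mergeMatrix n {i, j} := by
  classical
  refine (toMatrix_diag _).trans ?_
  ext f g
  rw [PartitionDiagram.toMatrix_apply, mergeMatrix, Matrix.diagonal_apply, ← ite_and]
  refine if_congr ⟨fun H => ⟨funext fun k => ?_, ?_⟩, ?_⟩ rfl rfl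
  · exact H (x := Sum.inl k) (y := Sum.inr k) (PartitionDiagram.pHalf_iff.2 (Or.inl rfl))
  · have : f i = f j := H (x := Sum.inl i) (y := Sum.inl j)
      (PartitionDiagram.pHalf_iff.2 (Or.inr (Or.inl ⟨rfl, hij⟩)))
    intro k hk l hl
    rcases hk with rfl | rfl <;> rcases hl with rfl | rfl <;> simp [this]
  · rintro ⟨rfl, h⟩ a b hab
    have hf : ∀ v, Sum.elim f f v = f (Sum.elim id id v) := by
      rintro (v | v) <;> rfl
    rw [Setoid.ker_def, hf, hf]
    rcases PartitionDiagram.pHalf_iff.1 hab with h1 | ⟨h1, h2⟩ | ⟨h1, h2⟩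
    · rw [h1]
    · exact h _ (Or.inl (Fin.ext (by omega))) _ (Or.inr (Fin.ext (by omega)))
    · exact h _ (Or.inr (Fin.ext (by omega))) _ (Or.inl (Fin.ext (by omega)))

theorem toMatrix_prod_map_p (l : ℕ) : ∀ m : ℕ, m + l ≤ r →
    toMatrix r n ((List.range' (m + 1) l).map (p r n)).prod =
      cutMatrix n {i : Fin r | m ≤ i ∧ (i : ℕ) < m + l} := by
  induction l with
  | zero =>
    intro m _
    have : {i : Fin r | m ≤ i ∧ (i : ℕ) < m + 0} = ∅ := by
      ext i
      simp only [Set.mem_ofPred_eq, Set.mem_empty_iff_false, iff_false]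
      omega
    rw [this, cutMatrix_empty]
    exact toMatrix_one
  | succ l ih =>
    intro m hm
    rw [List.range'_succ, List.map_cons, List.prod_cons, toMatrix_mul, ih (m + 1) (by omega),
      toMatrix_p (⟨m, by omega⟩ : Fin r), cutMatrix_singleton_mul]
    · congr 1
      ext i
      simp only [Set.mem_insert_iff, Set.mem_ofPred_eq, Fin.ext_iff]
      omega
    · simp

theorem toMatrix_e {k l : ℕ} (hl : l ≤ k) (hk : k ≤ r) :
    toMatrix r n (e r n k l) = cutMatrix n {i : Fin r | k - l ≤ i ∧ (i : ℕ) < k} := by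
  rw [e, toMatrix_prod_map_p l (k - l) (by omega), Nat.sub_add_cancel hl]

theorem toMatrix_prod_map_pHalf (l : ℕ) : ∀ m : ℕ, m + l < r →
    toMatrix r n ((List.range' (m + 1) l).map (pHalf r n)).prod =
      mergeMatrix n {i : Fin r | m ≤ i ∧ (i : ℕ) ≤ m + l} := by
  induction l with
  | zero =>
    intro m hm
    have : {i : Fin r | m ≤ i ∧ (i : ℕ) ≤ m + 0} = {⟨m, hm⟩} := by
      ext i
      simp only [Set.mem_ofPred_eq, Set.mem_singleton_iff, Fin.ext_iff]
      omega
    rw [this, mergeMatrix_singleton]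
    exact toMatrix_one
  | succ l ih =>
    intro m hm
    rw [List.range'_succ, List.map_cons, List.prod_cons, toMatrix_mul, ih (m + 1) (by omega),
      toMatrix_pHalf (i := ⟨m, by omega⟩) (j := ⟨m + 1, by omega⟩) rfl,
      mergeMatrix_mul (i := ⟨m + 1, by omega⟩) (Or.inr rfl) (by simp)]
    congr 1
    ext i
    simp only [Set.mem_union, Set.mem_insert_iff, Set.mem_singleton_iff, Set.mem_ofPred_eq,
      Fin.ext_iff]
    omega

theorem toMatrix_eHalf {k l : ℕ} (hl : l ≤ k) (hk : k < r) :
    toMatrix r n (eHalf r n k l) = mergeMatrix n {i : Fin r | k - l ≤ i ∧ (i : ℕ) ≤ k} := by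
  rw [eHalf, toMatrix_prod_map_pHalf l (k - l) (by omega), Nat.sub_add_cancel hl]

theorem toMatrix_list_prod_mem {k : ℕ} (L : List (PartitionAlgebra r n))
    (hL : ∀ x ∈ L, toMatrix r n x ∈ localMatrices r n k) :
    toMatrix r n L.prod ∈ localMatrices r n k := by
  rw [toMatrix_list_prod]
  refine Subalgebra.list_prod_mem _ fun X hX => ?_
  obtain ⟨x, hx, rfl⟩ := List.mem_map.1 hX
  exact hL x hx

theorem toMatrix_e_mem {k l : ℕ} (hl : l ≤ k) : toMatrix r n (e r n k l) ∈ localMatrices r n k := by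
  refine toMatrix_list_prod_mem _ fun x hx => ?_
  obtain ⟨j, hj, rfl⟩ := List.mem_map.1 hx
  rw [List.mem_range'_1] at hj
  rw [p, toMatrix_diag]
  exact PartitionDiagram.toMatrix_mem_localMatrices fun i hi =>
    PartitionDiagram.isStraight_p (by omega)

theorem toMatrix_eHalf_mem {k l : ℕ} (hl : l ≤ k) :
    toMatrix r n (eHalf r n k l) ∈ localMatrices r n (k + 1) := by
  refine toMatrix_list_prod_mem _ fun x hx => ?_
  obtain ⟨j, hj, rfl⟩ := List.mem_map.1 hx
  rw [List.mem_range'_1] at hj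
  rw [pHalf, toMatrix_diag]
  exact PartitionDiagram.toMatrix_mem_localMatrices fun i hi =>
    PartitionDiagram.isStraight_pHalf (by omega)

theorem toMatrix_s_mem {l k m : ℕ} (hl : l ≤ m) (hk : k ≤ m) :
    toMatrix r n (s r n l k) ∈ localMatrices r n m := by
  have hswap : ∀ j, j + 1 ≤ m → toMatrix r n (swap r n j) ∈ localMatrices r n m := by
    intro j hj
    rw [swap, toMatrix_diag]
    exact PartitionDiagram.toMatrix_mem_localMatrices fun i hi =>
      PartitionDiagram.isStraight_swap (by omega)
  rw [s]
  split_ifs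
  · rw [toMatrix_one]
    exact one_mem _
  · refine toMatrix_list_prod_mem _ fun x hx => ?_
    obtain ⟨j, hj, rfl⟩ := List.mem_map.1 hx
    rw [List.mem_range'_1] at hj
    exact hswap j (by omega)
  · refine toMatrix_list_prod_mem _ fun x hx => ?_
    obtain ⟨j, hj, rfl⟩ := List.mem_map.1 hx
    rw [List.mem_reverse, List.mem_range'_1] at hj
    exact hswap j (by omega)

end PartitionAlgebra

/-! ### Colourings -/

/-- The colour of the vertex numbered `v`, where `1 ≤ v ≤ r`; other numbers receive the
value `0`. -/
def color {r n : ℕ} (f : Fin r → Fin n) (v : ℕ) : ℕ :=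
  if h : 1 ≤ v ∧ v ≤ r then f ⟨v - 1, by omega⟩ else 0

section Color

variable {r n : ℕ}

theorem color_add_one (f : Fin r → Fin n) (i : Fin r) : color f (i + 1) = f i := by
  rw [color, dif_pos ⟨by omega, by omega⟩]
  congr

theorem exists_fin_of_mem {v : ℕ} (h1 : 1 ≤ v) (h2 : v ≤ r) : ∃ i : Fin r, v = i + 1 :=
  ⟨⟨v - 1, by omega⟩, by simp only; omega⟩

theorem color_eq_of_imp {f g : Fin r → Fin n} {v : ℕ}
    (h : ∀ i : Fin r, (i : ℕ) + 1 = v → f i = g i) : color f v = color g v := by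
  by_cases hv : 1 ≤ v ∧ v ≤ r
  · obtain ⟨i, rfl⟩ := exists_fin_of_mem hv.1 hv.2
    rw [color_add_one, color_add_one, h i rfl]
  · rw [color, color, dif_neg hv, dif_neg hv]

theorem exists_of_matrix_mul_ne_zero {X Y : Matrix (Fin r → Fin n) (Fin r → Fin n) ℚ}
    {f h : Fin r → Fin n} (H : (X * Y) f h ≠ 0) : ∃ g, X f g ≠ 0 ∧ Y g h ≠ 0 := by
  rw [Matrix.mul_apply] at H
  obtain ⟨g, -, hg⟩ := Finset.exists_ne_zero_of_sum_ne_zero H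
  exact ⟨g, left_ne_zero_of_mul hg, right_ne_zero_of_mul hg⟩

theorem eq_of_one_apply_ne_zero {f g : Fin r → Fin n}
    (H : (1 : Matrix (Fin r → Fin n) (Fin r → Fin n) ℚ) f g ≠ 0) : f = g := by
  by_contra hne
  exact H (Matrix.one_apply_ne hne)

theorem color_eq_of_mem_localMatrices {k : ℕ} {X : Matrix (Fin r → Fin n) (Fin r → Fin n) ℚ}
    (hX : X ∈ localMatrices r n k) {f g : Fin r → Fin n} (hfg : X f g ≠ 0) {v : ℕ}
    (hv : k < v) : color f v = color g v :=
  color_eq_of_imp fun i hi => eq_of_mem_localMatrices hX hfg (by omega)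

namespace PartitionAlgebra

theorem color_eq_of_swap {k : ℕ} (h1 : 1 ≤ k) (h2 : k + 1 ≤ r) {f g : Fin r → Fin n}
    (H : toMatrix r n (swap r n k) f g ≠ 0) (v : ℕ) :
    color f v = color g (if v = k then k + 1 else if v = k + 1 then k else v) := by
  rw [swap, toMatrix_diag, PartitionDiagram.toMatrix_apply] at H
  have H' : PartitionDiagram.swap r k ≤ Setoid.ker (Sum.elim f g) := by
    by_contra h
    exact H (if_neg h)
  have key : ∀ i j : Fin r, Equiv.swap k (k + 1) ((i : ℕ) + 1) = j + 1 → f i = g j :=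
    fun i j hij => H' (x := Sum.inl i) (y := Sum.inr j) hij
  rw [← Equiv.swap_apply_def]
  by_cases hv : 1 ≤ v ∧ v ≤ r
  · obtain ⟨i, rfl⟩ := exists_fin_of_mem hv.1 hv.2
    obtain ⟨j, hj⟩ : ∃ j : Fin r, Equiv.swap k (k + 1) ((i : ℕ) + 1) = j + 1 := by
      apply exists_fin_of_mem <;> rw [Equiv.swap_apply_def] <;> split_ifs <;> omega
    rw [hj, color_add_one, color_add_one, key i j hj]
  · rw [Equiv.swap_apply_of_ne_of_ne (by omega) (by omega), color, color, dif_neg hv, dif_neg hv]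

theorem color_of_prod_swap (m : ℕ) : ∀ {l : ℕ} {f g : Fin r → Fin n}, 1 ≤ l → l + m ≤ r →
    toMatrix r n ((List.range' l m).map (swap r n)).prod f g ≠ 0 →
      color f l = color g (l + m) ∧ (∀ v, l < v → v ≤ l + m → color f v = color g (v - 1)) ∧
        ∀ v, v < l ∨ l + m < v → color f v = color g v := by
  induction m with
  | zero =>
    intro l f g _ _ H
    have H : toMatrix r n 1 f g ≠ 0 := H
    rw [toMatrix_one] at H
    rw [eq_of_one_apply_ne_zero H]
    exact ⟨rfl, fun v _ _ => by omega, fun v _ => rfl⟩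
  | succ m ih =>
    intro l f h hl hm H
    rw [List.range'_succ, List.map_cons, List.prod_cons, toMatrix_mul] at H
    obtain ⟨g, h1, h2⟩ := exists_of_matrix_mul_ne_zero H
    have h1 := color_eq_of_swap hl (by omega) h1
    obtain ⟨h3, h4, h5⟩ := ih (by omega) (by omega) h2
    refine ⟨?_, fun v hv hv' => ?_, fun v hv => ?_⟩
    · rw [h1, if_pos rfl, h3]
      congr 1
      omega
    · by_cases hvl : v = l + 1
      · rw [h1, if_neg (by omega), if_pos hvl, h5 l (by omega)]
        congr 1
        omega
      · rw [h1, if_neg (by omega), if_neg hvl]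
        exact h4 v (by omega) (by omega)
    · rw [h1, if_neg (by omega), if_neg (by omega)]
      exact h5 v (by omega)

theorem color_of_prod_reverse_swap (m : ℕ) : ∀ {l : ℕ} {f g : Fin r → Fin n}, 1 ≤ l → l + m ≤ r →
    toMatrix r n ((List.range' l m).reverse.map (swap r n)).prod f g ≠ 0 →
      color f (l + m) = color g l ∧ (∀ v, l ≤ v → v < l + m → color f v = color g (v + 1)) ∧
        ∀ v, v < l ∨ l + m < v → color f v = color g v := by
  induction m with
  | zero =>
    intro l f g _ _ H
    have H : toMatrix r n 1 f g ≠ 0 := H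
    rw [toMatrix_one] at H
    rw [eq_of_one_apply_ne_zero H]
    exact ⟨rfl, fun v _ _ => by omega, fun v _ => rfl⟩
  | succ m ih =>
    intro l f h hl hm H
    rw [List.range'_succ, List.reverse_cons, List.map_append, toMatrix_list_prod, List.map_append,
      List.prod_append, ← toMatrix_list_prod] at H
    obtain ⟨g, h2, h1⟩ := exists_of_matrix_mul_ne_zero H
    rw [List.map_singleton, List.map_singleton, List.prod_singleton] at h1
    have h1 := color_eq_of_swap hl (by omega) h1
    obtain ⟨h3, h4, h5⟩ := ih (by omega) (by omega) h2
    refine ⟨?_, fun v hv hv' => ?_, fun v hv => ?_⟩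
    · rw [show l + (m + 1) = l + 1 + m by omega, h3, h1, if_neg (by omega), if_pos rfl]
    · by_cases hvl : v = l
      · rw [h5 v (by omega), h1, if_pos hvl, hvl]
      · rw [h4 v (by omega) (by omega), h1, if_neg (by omega), if_neg (by omega)]
    · rw [h5 v (by omega), h1, if_neg (by omega), if_neg (by omega)]

/-- For `l ≤ k` the element `s_{l,k}` moves the strand `k` to position `l`. -/
theorem color_of_s_of_le {l k : ℕ} (hl : 1 ≤ l) (hlk : l ≤ k) (hk : k ≤ r) {f g : Fin r → Fin n}
    (H : toMatrix r n (s r n l k) f g ≠ 0) :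
    color f l = color g k ∧ (∀ v, l < v → v ≤ k → color f v = color g (v - 1)) ∧
      ∀ v, v < l ∨ k < v → color f v = color g v := by
  rw [s, if_neg (by omega), if_pos hlk] at H
  have := color_of_prod_swap (k - l) hl (by omega) H
  rwa [Nat.add_sub_cancel' hlk] at this

/-- For `k ≤ l` the element `s_{l,k}` moves the strand `k` to position `l`. -/
theorem color_of_s_of_ge {l k : ℕ} (hk : 1 ≤ k) (hkl : k ≤ l) (hl : l ≤ r) {f g : Fin r → Fin n}
    (H : toMatrix r n (s r n l k) f g ≠ 0) :
    color f l = color g k ∧ (∀ v, k ≤ v → v < l → color f v = color g (v + 1)) ∧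
      ∀ v, v < k ∨ l < v → color f v = color g v := by
  by_cases h : l = k
  · subst h
    obtain ⟨h1, -, h3⟩ := color_of_s_of_le hk le_rfl hl H
    exact ⟨h1, fun v _ _ => by omega, h3⟩
  · rw [s, if_neg (by omega), if_neg (by omega)] at H
    have := color_of_prod_reverse_swap (l - k) hk (by omega) H
    rwa [Nat.add_sub_cancel' hkl] at this

end PartitionAlgebra

end Color

/-! ### Partial sums of partitions and fresh strands -/

namespace YoungDiagram

theorem partialSum_zero (lam : YoungDiagram) : lam.partialSum 0 = 0 := rfl

theorem partialSum_succ (lam : YoungDiagram) (a : ℕ) :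
    lam.partialSum (a + 1) = lam.partialSum a + lam.rowLen a :=
  Finset.sum_range_succ _ _

theorem partialSum_mono (lam : YoungDiagram) : Monotone lam.partialSum :=
  monotone_nat_of_le_succ fun a => by
    rw [partialSum_succ]
    exact Nat.le_add_right _ _

theorem card_eq_partialSum {lam : YoungDiagram} {a : ℕ} (ha : lam.colLen 0 ≤ a) :
    lam.card = lam.partialSum a := by
  refine (Finset.card_eq_sum_card_fiberwise (f := Prod.fst) (t := Finset.range a) ?_).trans ?_
  · rintro ⟨i, j⟩ hc
    have h1 : (i, 0) ∈ lam := lam.up_left_mem le_rfl (Nat.zero_le j) hc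
    exact Finset.mem_coe.2 (Finset.mem_range.2 ((mem_iff_lt_colLen.1 h1).trans_le ha))
  · exact Finset.sum_congr rfl fun i _ => (lam.rowLen_eq_card).symm

theorem partialSum_le_card (lam : YoungDiagram) (a : ℕ) : lam.partialSum a ≤ lam.card := by
  rw [card_eq_partialSum (le_max_left (lam.colLen 0) a)]
  exact lam.partialSum_mono (le_max_right _ _)

theorem AddsBox.partialSum {κ ν : YoungDiagram} {b : ℕ} (h : κ.AddsBox b ν) (j : ℕ) :
    ν.partialSum j = κ.partialSum j + if 1 ≤ b ∧ b ≤ j then 1 else 0 := by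
  induction j with
  | zero =>
    rw [if_neg (by omega)]
    rfl
  | succ j ih =>
    rw [partialSum_succ, partialSum_succ, ih, h j]
    split_ifs <;> omega

theorem AddsBox.card {κ ν : YoungDiagram} {b : ℕ} (h : κ.AddsBox b ν) :
    ν.card = κ.card + if 1 ≤ b then 1 else 0 := by
  have h1 : κ.colLen 0 ≤ κ.colLen 0 + ν.colLen 0 + b := by omega
  have h2 : ν.colLen 0 ≤ κ.colLen 0 + ν.colLen 0 + b := by omega
  rw [card_eq_partialSum h1, card_eq_partialSum h2, h.partialSum]
  congr 1
  exact if_congr ⟨fun h => h.1, fun h => ⟨h, by omega⟩⟩ rfl rfl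

theorem card_bot : (⊥ : YoungDiagram).card = 0 := rfl

/-- The number of positions in row `i + 1` of `lam`, in the row reading of `lam` that numbers the
boxes from `1`, at which the colouring `c` takes a value outside `H`. -/
def freshCount (lam : YoungDiagram) (i : ℕ) (c : ℕ → ℕ) (H : Finset ℕ) : ℕ :=
  ((Finset.Ioc (lam.partialSum i) (lam.partialSum (i + 1))).filter fun v => c v ∉ H).card

theorem freshCount_le (lam : YoungDiagram) (i : ℕ) (c : ℕ → ℕ) (H : Finset ℕ) :
    lam.freshCount i c H ≤ lam.rowLen i := by
  refine (Finset.card_filter_le _ _).trans ?_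
  rw [Nat.card_Ioc, partialSum_succ]
  omega

/-- Suppose that a box is removed from row `a`, that the last strand of row `a` has a colour outside
`H`, and that the strands behind it move down by one position.  If `a` is the row in question, the
number of fresh strands drops. -/
theorem AddsBox.freshCount_remove {κ μ : YoungDiagram} {a : ℕ} (h : κ.AddsBox a μ) (i : ℕ)
    {c c' : ℕ → ℕ} {H H' : Finset ℕ} (hH : H ⊆ H') (h0 : a = 0 → ∀ v, c v = c' v)
    (h1 : 1 ≤ a → c' (μ.partialSum a) ∉ H ∧
      ∀ v, v < μ.card → c v = c' (if v < μ.partialSum a then v else v + 1)) :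
    κ.freshCount i c H' + (if a = i + 1 then 1 else 0) ≤ μ.freshCount i c' H := by
  have hi := h.partialSum i
  have hi1 := h.partialSum (i + 1)
  by_cases ha : a = 0
  · rw [if_neg (by omega)] at hi hi1 ⊢
    simp only [freshCount, hi, hi1, add_zero]
    refine Finset.card_le_card fun v hv => ?_
    rw [Finset.mem_filter] at hv ⊢
    exact ⟨hv.1, fun h' => hv.2 (hH (by rwa [h0 ha]))⟩
  · obtain ⟨h2, h3⟩ := h1 (by omega)
    have hcard := h.card
    have hle := κ.partialSum_le_card (i + 1)
    have haa := h.partialSum a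
    rw [if_pos (by omega)] at hcard haa
    set φ : ℕ → ℕ := fun v => if v < μ.partialSum a then v else v + 1 with hφ
    have hφinj : Function.Injective φ := by
      intro v w hvw
      simp only [hφ] at hvw
      split_ifs at hvw <;> omega
    have himage : ∀ v, v ∈ (Finset.Ioc (κ.partialSum i) (κ.partialSum (i + 1))).filter
        (fun v => c v ∉ H') → φ v ≠ μ.partialSum a ∧ φ v ∈
          (Finset.Ioc (μ.partialSum i) (μ.partialSum (i + 1))).filter fun v => c' v ∉ H := by
      intro v hv
      rw [Finset.mem_filter, Finset.mem_Ioc] at hv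
      rw [Finset.mem_filter, Finset.mem_Ioc]
      have hne : φ v ≠ μ.partialSum a := by
        simp only [hφ]
        split_ifs <;> omega
      refine ⟨hne, ?_, fun h' => hv.2 (hH ?_)⟩
      · rcases lt_trichotomy a (i + 1) with hlt | heq | hgt
        · have := κ.partialSum_mono (show a ≤ i by omega)
          rw [if_pos (by omega)] at hi hi1
          simp only [hφ]
          split_ifs <;> omega
        · subst heq
          rw [if_neg (by omega)] at hi
          simp only [hφ]
          split_ifs <;> omega
        · have := κ.partialSum_mono (show i + 1 ≤ a by omega)
          rw [if_neg (by omega)] at hi hi1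
          simp only [hφ]
          split_ifs <;> omega
      · rwa [h3 v (by omega)]
    rw [freshCount, freshCount, ← Finset.card_image_of_injective _ hφinj]
    split_ifs with hai
    · have hmem : μ.partialSum a ∈ (Finset.Ioc (μ.partialSum i) (μ.partialSum (i + 1))).filter
          fun v => c' v ∉ H := by
        subst hai
        rw [Finset.mem_filter, Finset.mem_Ioc]
        rw [if_neg (by omega)] at hi
        have := κ.partialSum_mono (show i ≤ i + 1 by omega)
        exact ⟨⟨by omega, le_rfl⟩, h2⟩
      rw [← Finset.card_erase_add_one hmem]
      refine Nat.add_le_add_right (Finset.card_le_card fun w hw => ?_) 1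
      obtain ⟨v, hv, rfl⟩ := Finset.mem_image.1 hw
      exact Finset.mem_erase.2 (himage v hv)
    · rw [add_zero]
      refine Finset.card_le_card fun w hw => ?_
      obtain ⟨v, hv, rfl⟩ := Finset.mem_image.1 hw
      exact (himage v hv).2

/-- Adding a box whose strand has a colour in `H` does not increase the number of fresh strands. -/
theorem AddsBox.freshCount_add {κ ν : YoungDiagram} {b : ℕ} (h : κ.AddsBox b ν) (i : ℕ)
    {c c' : ℕ → ℕ} {H : Finset ℕ} (h0 : b = 0 → ∀ v, v ≤ ν.card → c v = c' v)
    (h1 : 1 ≤ b → ∃ l, ν.partialSum (b - 1) < l ∧ l ≤ ν.partialSum b ∧ c l ∈ H ∧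
      (∀ v, v < l → c v = c' v) ∧ ∀ v, l < v → v ≤ ν.card → c v = c' (v - 1)) :
    ν.freshCount i c H ≤ κ.freshCount i c' H := by
  have hi := h.partialSum i
  have hi1 := h.partialSum (i + 1)
  have hle := ν.partialSum_le_card (i + 1)
  by_cases hb : b = 0
  · rw [if_neg (by omega)] at hi hi1
    simp only [freshCount, hi, hi1, add_zero]
    refine Finset.card_le_card fun v hv => ?_
    rw [Finset.mem_filter, Finset.mem_Ioc] at hv ⊢
    refine ⟨hv.1, ?_⟩
    rw [← h0 hb v (by omega)]
    exact hv.2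
  · obtain ⟨l, hl1, hl2, hl3, hl4, hl5⟩ := h1 (by omega)
    refine Finset.card_le_card_of_injOn (fun v => if v < l then v else v - 1) ?_ ?_
    · intro v hv
      rw [Finset.mem_coe, Finset.mem_filter, Finset.mem_Ioc] at hv
      rw [Finset.mem_coe, Finset.mem_filter, Finset.mem_Ioc]
      have hvl : v ≠ l := by
        rintro rfl
        exact hv.2 hl3
      refine ⟨?_, ?_⟩
      · rcases lt_trichotomy b (i + 1) with hlt | heq | hgt
        · have := ν.partialSum_mono (show b ≤ i by omega)
          rw [if_pos (by omega)] at hi hi1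
          simp only
          split_ifs <;> omega
        · subst heq
          rw [if_neg (by omega)] at hi
          rw [if_pos (by omega)] at hi1
          rw [Nat.add_sub_cancel] at hl1
          simp only
          split_ifs <;> omega
        · have := ν.partialSum_mono (show i + 1 ≤ b - 1 by omega)
          rw [if_neg (by omega)] at hi hi1
          simp only
          split_ifs <;> omega
      · simp only
        split_ifs with hlt
        · rw [← hl4 v hlt]
          exact hv.2
        · rw [← hl5 v (by omega) (by omega)]
          exact hv.2
    · intro v hv w hw hvw
      rw [Finset.mem_coe, Finset.mem_filter, Finset.mem_Ioc] at hv hw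
      have hvl : v ≠ l := by
        rintro rfl
        exact hv.2 hl3
      have hwl : w ≠ l := by
        rintro rfl
        exact hw.2 hl3
      simp only at hvw
      split_ifs at hvw <;> omega

end YoungDiagram

/-! ### The action of the branching coefficients -/

namespace KroneckerTableau

open PartitionAlgebra

variable {r n : ℕ}

theorem card_le {lam μ : YoungDiagram} {k : ℕ} (t : KroneckerTableau lam k μ) :
    μ.card ≤ lam.card + k := by
  induction t with
  | nil => rfl
  | snoc t a b κ ν hremove hadd ih =>
    have h1 := hremove.card
    have h2 := hadd.card
    split_ifs at h1 h2 <;> omega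

/-- The strand removed from row `a` is joined to the strand `k + 1`, and so are the
positions from `|κ| + 1` on. -/
theorem color_of_uRemove {k a : ℕ} {μ κ : YoungDiagram} (h : κ.AddsBox a μ) (hμ : μ.card ≤ k)
    (hk : k < r) {f g : Fin r → Fin n} (H : toMatrix r n (uRemove r n k μ a κ) f g ≠ 0) :
    color f (κ.card + 1) = color g (k + 1) ∧ (a = 0 → f = g) ∧
      (1 ≤ a → color g (μ.partialSum a) = color g (k + 1) ∧
        ∀ v, v < μ.card → color f v = color g (if v < μ.partialSum a then v else v + 1)) := by
  have hcard := h.card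
  rw [uRemove, toMatrix_mul, toMatrix_eHalf (by omega) hk] at H
  obtain ⟨f', h1, h2⟩ := exists_of_matrix_mul_ne_zero H
  classical
  rw [mergeMatrix, Matrix.diagonal_apply] at h1
  obtain ⟨rfl, hne⟩ := ite_ne_right_iff.1 h1
  replace h1 := (ite_ne_right_iff.1 hne).1
  have h3 : color f (κ.card + 1) = color f (k + 1) := by
    have hκ : κ.card < r := by omega
    have := h1 ⟨κ.card, hκ⟩ (by simp only [Set.mem_ofPred_eq]; omega) ⟨k, hk⟩
      (by simp only [Set.mem_ofPred_eq]; omega)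
    exact (color_add_one f ⟨κ.card, hκ⟩).trans
      ((congrArg Fin.val this).trans (color_add_one f ⟨k, hk⟩).symm)
  by_cases ha : a = 0
  · subst ha
    have : f = g := by
      rw [μ.partialSum_zero, s, if_pos (Or.inr rfl), toMatrix_one] at h2
      exact eq_of_one_apply_ne_zero h2
    subst this
    exact ⟨h3, fun _ => rfl, fun h' => absurd h' (by omega)⟩
  · have haa := h.partialSum a
    have hle := μ.partialSum_le_card a
    rw [if_pos (by omega)] at haa hcard
    obtain ⟨h4, h5, h6⟩ := color_of_s_of_ge (by omega) hle (by omega) h2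
    have h7 : color f (k + 1) = color g (k + 1) := h6 _ (Or.inr (by omega))
    refine ⟨h3.trans h7, fun h' => absurd h' ha, fun _ => ⟨?_, fun v hv => ?_⟩⟩
    · rw [← h4, ← h7, ← h3, hcard]
    · split_ifs with hva
      · exact h6 v (Or.inl hva)
      · exact h5 v (by omega) hv

/-- The strand in the last position is moved to an arbitrary position `l` of row `b`. -/
theorem color_of_uAdd {k b : ℕ} {ν κ : YoungDiagram} (h : κ.AddsBox b ν) (hν : ν.card ≤ k + 1)
    (hk : k < r) {f g : Fin r → Fin n} (H : toMatrix r n (uAdd r n k ν b) f g ≠ 0) :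
    (b = 0 → ∀ v, v ≤ ν.card → color f v = color g v) ∧
      (1 ≤ b → ∃ l, ν.partialSum (b - 1) < l ∧ l ≤ ν.partialSum b ∧ color f l = color g ν.card ∧
        (∀ v, v < l → color f v = color g v) ∧
          ∀ v, l < v → v ≤ ν.card → color f v = color g (v - 1)) := by
  classical
  rw [uAdd, toMatrix_mul, toMatrix_mul, toMatrix_e (by omega) (by omega)] at H
  obtain ⟨f₂, h12, h2⟩ := exists_of_matrix_mul_ne_zero H
  obtain ⟨f₁, h0, h1⟩ := exists_of_matrix_mul_ne_zero h12
  have h3 : ∀ v, v ≤ ν.card → color f v = color f₁ v := by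
    intro v hv
    refine color_eq_of_imp fun i hi => ?_
    rw [cutMatrix_apply] at h0
    refine (ite_ne_right_iff.1 h0).1 ?_
    simp only [Set.mem_compl_iff, Set.mem_ofPred_eq]
    omega
  by_cases hb : b = 0
  · subst hb
    rw [rowSum, if_pos rfl, toMatrix_one] at h1
    rw [ν.partialSum_zero, s, if_pos (Or.inl rfl), toMatrix_one] at h2
    rw [← eq_of_one_apply_ne_zero h2, ← eq_of_one_apply_ne_zero h1]
    exact ⟨fun _ => h3, fun h' => absurd h' (by omega)⟩
  · refine ⟨fun h' => absurd h' hb, fun _ => ?_⟩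
    obtain ⟨c, rfl⟩ : ∃ c, b = c + 1 := ⟨b - 1, by omega⟩
    have hle := ν.partialSum_le_card (c + 1)
    have hsucc := ν.partialSum_succ c
    have hpos := h.partialSum (c + 1)
    rw [if_pos (by omega)] at hpos
    rw [rowSum, if_neg hb, map_sum, Matrix.sum_apply] at h1
    obtain ⟨j, hj, h1⟩ := Finset.exists_ne_zero_of_sum_ne_zero h1
    rw [Finset.mem_range] at hj
    have hj : j < ν.rowLen c := hj
    obtain ⟨h4, h5, h6⟩ := color_of_s_of_le (by omega) (by omega) (by omega) h1
    obtain ⟨h7, h8, h9⟩ := color_of_s_of_le (by omega) hle (by omega) h2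
    refine ⟨ν.partialSum (c + 1) - j, by rw [Nat.add_sub_cancel]; omega, by omega, ?_,
      fun v hv => ?_, fun v hv hv' => ?_⟩
    · rw [h3 _ (by omega), h4, h7]
    · rw [h3 _ (by omega), h6 v (by omega), h9 v (by omega)]
    · rw [h3 v hv']
      by_cases hvc : v ≤ ν.partialSum (c + 1)
      · rw [h5 v hv hvc, h9 _ (by omega)]
      · rw [h6 v (by omega), h8 v (by omega) hv']

theorem toMatrix_rowSum_mem {m : ℕ} (ν : YoungDiagram) (b : ℕ) (hν : ν.card ≤ m) :
    toMatrix r n (rowSum r n ν b) ∈ localMatrices r n m := by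
  have := ν.partialSum_le_card b
  rw [rowSum]
  split_ifs
  · rw [toMatrix_one]
    exact one_mem _
  · rw [map_sum]
    exact sum_mem fun j _ => toMatrix_s_mem (by omega) (by omega)

theorem toMatrix_uRemove_mem {k : ℕ} (a : ℕ) {μ : YoungDiagram} (κ : YoungDiagram)
    (hμ : μ.card ≤ k) : toMatrix r n (uRemove r n k μ a κ) ∈ localMatrices r n (k + 1) := by
  have := μ.partialSum_le_card a
  rw [uRemove, toMatrix_mul]
  exact mul_mem (toMatrix_eHalf_mem (by omega)) (toMatrix_s_mem (by omega) (by omega))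

/-- The strands that the path has not reached yet are vertical in `u_t`. -/
theorem toMatrix_u_mem {k : ℕ} {μ : YoungDiagram} (t : KroneckerTableau ⊥ k μ) :
    toMatrix r n (u r n t) ∈ localMatrices r n k := by
  induction t with
  | nil =>
    rw [u, toMatrix_one]
    exact one_mem _
  | @snoc k μ t a b κ ν hremove hadd ih =>
    have h1 := t.card_le
    have h2 := (snoc t a b κ ν hremove hadd).card_le
    rw [YoungDiagram.card_bot, zero_add] at h1 h2
    have h3 := ν.partialSum_le_card b
    rw [u, uAdd]
    simp only [toMatrix_mul]
    exact mul_mem (mul_mem (mul_mem (mul_mem (toMatrix_e_mem (by omega))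
      (toMatrix_rowSum_mem ν b h2)) (toMatrix_s_mem (by omega) (by omega)))
      (toMatrix_uRemove_mem a κ h1)) (localMatrices_mono (Nat.le_succ k) ih)

/-- The northern vertices of `u_t` above the size of the final partition are isolated. -/
theorem exists_toMatrix_u_eq {k : ℕ} {ν : YoungDiagram} (t : KroneckerTableau ⊥ k ν) (hk : k ≤ r) :
    ∃ W ∈ localMatrices r n k, toMatrix r n (u r n t) =
      cutMatrix n {i : Fin r | ν.card ≤ i ∧ (i : ℕ) < k} * W := by
  cases t with
  | nil =>
    refine ⟨1, one_mem _, ?_⟩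
    have : {i : Fin r | (⊥ : YoungDiagram).card ≤ i ∧ (i : ℕ) < 0} = ∅ := by
      ext i
      simp only [Set.mem_ofPred_eq, Set.mem_empty_iff_false, iff_false]
      omega
    rw [this, cutMatrix_empty, u, toMatrix_one, mul_one]
  | @snoc k μ t a b κ _ hremove hadd =>
    have h1 := t.card_le
    have h2 := (snoc t a b κ ν hremove hadd).card_le
    rw [YoungDiagram.card_bot, zero_add] at h1 h2
    have h3 := ν.partialSum_le_card b
    refine ⟨_, mul_mem (mul_mem (mul_mem (toMatrix_rowSum_mem ν b h2)
      (toMatrix_s_mem (l := ν.partialSum b) (k := ν.card) (by omega) (by omega)))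
      (toMatrix_uRemove_mem a κ h1)) (localMatrices_mono (Nat.le_succ k) (toMatrix_u_mem t)), ?_⟩
    rw [u, uAdd]
    simp only [toMatrix_mul, toMatrix_e (Nat.sub_le _ _) hk, Nat.sub_sub_self h2, mul_assoc]

/-- An integral step `(-ε_0, +ε_0)` isolates a southern vertex. -/
theorem toMatrix_u_snoc_zero_mul {k : ℕ} {μ κ ν : YoungDiagram} (t : KroneckerTableau ⊥ k μ)
    (hremove : κ.AddsBox 0 μ) (hadd : κ.AddsBox 0 ν) (hk : k < r) :
    toMatrix r n (u r n (snoc t 0 0 κ ν hremove hadd)) * cutMatrix n {⟨k, hk⟩} =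
      (n : ℚ) • toMatrix r n (u r n (snoc t 0 0 κ ν hremove hadd)) := by
  obtain ⟨W, hW, htW⟩ := exists_toMatrix_u_eq (n := n) t hk.le
  have h1 := t.card_le
  rw [YoungDiagram.card_bot, zero_add] at h1
  have h2 : μ.card = κ.card := hremove.card
  have h3 : ν.card = κ.card := hadd.card
  have hs1 : s r n μ.card (μ.partialSum 0) = 1 := if_pos (Or.inr rfl)
  have hs2 : s r n (ν.partialSum 0) ν.card = 1 := if_pos (Or.inl rfl)
  have hr : rowSum r n ν 0 = 1 := if_pos rfl
  have hT : {i : Fin r | κ.card ≤ i ∧ (i : ℕ) < k + 1} =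
      insert ⟨k, hk⟩ {i : Fin r | κ.card ≤ i ∧ (i : ℕ) < k} := by
    ext i
    simp only [Set.mem_insert_iff, Set.mem_ofPred_eq, Fin.ext_iff]
    omega
  have hT' : {i : Fin r | κ.card ≤ i ∧ (i : ℕ) ≤ k} =
      insert ⟨k, hk⟩ {i : Fin r | κ.card ≤ i ∧ (i : ℕ) < k} := by
    ext i
    simp only [Set.mem_insert_iff, Set.mem_ofPred_eq, Fin.ext_iff]
    omega
  have hu : toMatrix r n (u r n (snoc t 0 0 κ ν hremove hadd)) =
      cutMatrix n (insert ⟨k, hk⟩ {i : Fin r | κ.card ≤ i ∧ (i : ℕ) < k}) * W := by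
    rw [u, uAdd, uRemove, hs1, hs2, hr]
    simp only [toMatrix_mul, toMatrix_one, mul_one, htW]
    rw [toMatrix_e (by omega) (by omega), toMatrix_eHalf (by omega) hk, h2, h3,
      Nat.sub_sub_self (by omega), Nat.sub_sub_self (by omega), hT, hT', ← mul_assoc,
      cutMatrix_mul_mergeMatrix_mul (by simp)]
  rw [hu, mul_assoc, ← cutMatrix_mul_comm_of_mem_localMatrices hW (i := ⟨k, hk⟩) le_rfl,
    ← mul_assoc, cutMatrix_mul_singleton (Set.mem_insert _ _), Matrix.smul_mul]

theorem exists_toMatrix_u_comp_mul {lam ν : YoungDiagram} {s : ℕ}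
    (t₀ : KroneckerTableau ⊥ lam.card lam) (t : KroneckerTableau lam s ν) (ht : t.IsDRZero)
    (hr : lam.card + s ≤ r) :
    ∃ j : Fin r, lam.card ≤ j ∧ toMatrix r n (u r n (t₀.comp t)) * cutMatrix n {j} =
      (n : ℚ) • toMatrix r n (u r n (t₀.comp t)) := by
  induction t with
  | nil => simp [IsDRZero, steps] at ht
  | @snoc s μ t a b κ ν hremove hadd ih =>
    by_cases hab : (a, b) = (0, 0)
    · obtain ⟨rfl, rfl⟩ := Prod.mk.inj hab
      exact ⟨⟨lam.card + s, by omega⟩, by simp only; omega,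
        toMatrix_u_snoc_zero_mul (t₀.comp t) hremove hadd (by omega)⟩
    · have ht' : t.IsDRZero := by
        simpa [IsDRZero, steps, List.countP_append, hab] using ht
      obtain ⟨j, hj, h⟩ := ih ht' (by omega)
      refine ⟨j, hj, ?_⟩
      rw [comp, u, toMatrix_mul, mul_assoc, h, Matrix.mul_smul]

/-- Over a colouring of the southern vertices that is injective on those after `|λ|`, every removal
from row `i + 1` uses up one of the `λ_{i+1}` strands of that row that do not yet carry the colour of
such a vertex. -/
theorem freshCount_add_countP_le {lam ν : YoungDiagram} {s : ℕ} (i : ℕ)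
    (t₀ : KroneckerTableau ⊥ lam.card lam) (t : KroneckerTableau lam s ν) (hr : lam.card + s ≤ r)
    {g h : Fin r → Fin n} (hh : Set.InjOn (color h) (Set.Ioc lam.card r))
    (H : toMatrix r n (u r n (t₀.comp t)) g h ≠ 0) :
    ν.freshCount i (color g) ((Finset.Ioc lam.card (lam.card + s)).image (color h)) +
      t.steps.countP (fun q => q.1 = i + 1) ≤ lam.rowLen i := by
  induction t generalizing g with
  | nil => exact lam.freshCount_le _ _ _
  | @snoc s μ t a b κ ν hremove hadd ih =>
    have hμ := (t₀.comp t).card_le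
    rw [YoungDiagram.card_bot, zero_add] at hμ
    have hν := ((t₀.comp t).snoc a b κ ν hremove hadd).card_le
    rw [YoungDiagram.card_bot, zero_add] at hν
    rw [comp, u, toMatrix_mul, toMatrix_mul] at H
    obtain ⟨g₂, H12, H3⟩ := exists_of_matrix_mul_ne_zero H
    obtain ⟨g₁, H1, H2⟩ := exists_of_matrix_mul_ne_zero H12
    have hIH := ih (by omega) H3
    have hlast : color g₂ (lam.card + s + 1) = color h (lam.card + s + 1) :=
      color_eq_of_mem_localMatrices (toMatrix_u_mem (t₀.comp t)) H3 (Nat.lt_succ_self _)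
    obtain ⟨r1, r2, r3⟩ := color_of_uRemove hremove hμ (by omega) H2
    obtain ⟨a1, a2⟩ := color_of_uAdd hadd hν (by omega) H1
    have hsub : (Finset.Ioc lam.card (lam.card + s)).image (color h) ⊆
        (Finset.Ioc lam.card (lam.card + (s + 1))).image (color h) :=
      Finset.image_subset_image (Finset.Ioc_subset_Ioc_right (by omega))
    have hrem := hremove.freshCount_remove i hsub (c := color g₁) (c' := color g₂)
      (fun h' v => by rw [r2 h']) fun h' => ⟨?_, (r3 h').2⟩
    · have hadd' := hadd.freshCount_add i (c := color g) (c' := color g₁)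
        (H := (Finset.Ioc lam.card (lam.card + (s + 1))).image (color h)) a1 fun h' => ?_
      · rw [steps, List.countP_append, List.countP_singleton]
        simp only [decide_eq_true_eq]
        omega
      · obtain ⟨l, l1, l2, l3, l4, l5⟩ := a2 h'
        refine ⟨l, l1, l2, ?_, l4, l5⟩
        have hcard := hadd.card
        rw [if_pos h'] at hcard
        rw [l3, hcard, r1, hlast]
        exact Finset.mem_image_of_mem _ (Finset.mem_Ioc.2 ⟨by omega, by omega⟩)
    -- The removed strand has the colour of a new southern vertex, which is outside `H` as `h` is
    -- injective.
    · rw [(r3 h').1, hlast]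
      intro hmem
      obtain ⟨v, hv, hveq⟩ := Finset.mem_image.1 hmem
      rw [Finset.mem_Ioc] at hv
      have := hh ⟨hv.1, by omega⟩ ⟨by omega, by omega⟩ hveq
      omega

end KroneckerTableau

/-! ### The ideal generated by `p_r` -/

namespace PartitionAlgebra

variable {r n s : ℕ}

/-- The diagram whose blocks are the classes of `τ`, where the northern vertices are labelled by
`i` and the southern vertices by `σ i`: the strands are permuted by `σ` and merged along `τ` at their
northern ends. -/
@[reducible] def mergeNorth (τ : Setoid (Fin r)) (σ : Equiv.Perm (Fin r)) : PartitionDiagram r :=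
  Setoid.comap (Sum.elim id σ) τ

/-- The diagram whose blocks are the classes of `τ`, where the northern vertices are labelled by
`σ i` and the southern vertices by `i`: the strands are permuted by `σ` and merged along `τ` at their
southern ends. -/
@[reducible] def mergeSouth (τ : Setoid (Fin r)) (σ : Equiv.Perm (Fin r)) : PartitionDiagram r :=
  Setoid.comap (Sum.elim σ id) τ

theorem mergeNorth_le_ker_iff {τ : Setoid (Fin r)} {σ : Equiv.Perm (Fin r)}
    {f g : Fin r → Fin n} :
    mergeNorth τ σ ≤ Setoid.ker (Sum.elim f g) ↔ τ ≤ Setoid.ker f ∧ g = f ∘ σ := by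
  constructor
  · intro H
    refine ⟨fun i j hij => H (x := Sum.inl i) (y := Sum.inl j) hij, funext fun i => ?_⟩
    exact (H (x := Sum.inl (σ i)) (y := Sum.inr i) (τ.refl _)).symm
  · rintro ⟨H, rfl⟩ (a | a) (b | b) hab <;> exact H hab

theorem mergeSouth_le_ker_iff {τ : Setoid (Fin r)} {σ : Equiv.Perm (Fin r)}
    {f g : Fin r → Fin n} :
    mergeSouth τ σ ≤ Setoid.ker (Sum.elim f g) ↔ τ ≤ Setoid.ker g ∧ f = g ∘ σ := by
  constructor
  · intro H
    refine ⟨fun i j hij => H (x := Sum.inr i) (y := Sum.inr j) hij, funext fun i => ?_⟩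
    exact H (x := Sum.inl i) (y := Sum.inr (σ i)) (τ.refl _)
  · rintro ⟨H, rfl⟩ (a | a) (b | b) hab <;> exact H hab

/-- The set-partition of the strands of `P_r(n)` whose only possibly non-singleton block consists of
the last `s` strands. -/
@[reducible] def lastBlock (r s : ℕ) : Setoid (Fin r) :=
  Setoid.ker fun i : Fin r => if (i : ℕ) < r - s then (i : ℕ) + 1 else 0

theorem eq_of_le_lastBlock {τ : Setoid (Fin r)} (hτ : τ ≤ lastBlock r s) {i j : Fin r}
    (hi : (i : ℕ) < r - s) (hij : τ i j) : j = i := by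
  have := hτ hij
  rw [Setoid.ker_def, if_pos hi] at this
  split_ifs at this
  · exact Fin.ext (by omega)

open Classical in
/-- Merging along `τ`, cutting strand `j` and merging along `τ` again is an element of the ideal
`P_s(n) p_r P_s(n)`, for `τ` and `j` supported on the last `s` strands. -/
theorem exists_mem_depthIdeal {τ : Setoid (Fin r)} (hτ : τ ≤ lastBlock r s) {j : Fin r}
    (hj : r - s ≤ j) : ∃ y ∈ depthIdeal r n s, ∀ f h, toMatrix r n y f h =
      if τ ≤ Setoid.ker f ∧ τ ≤ Setoid.ker h ∧ Set.EqOn f h {j}ᶜ then 1 else 0 := by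
  let last : Fin r := ⟨r - 1, by omega⟩
  let σ : Equiv.Perm (Fin r) := Equiv.swap j last
  have hσ : ∀ i, σ (σ i) = i := Equiv.swap_apply_self j last
  have hσ1 : ∀ i : Fin r, (i : ℕ) < r - s → σ i = i := fun i hi =>
    Equiv.swap_apply_of_ne_of_ne (by rintro rfl; omega)
      (by rintro rfl; simp only [last] at hi; omega)
  have hfix : ∀ i k : Fin r, (i : ℕ) < r - s → (τ i (σ k) ↔ k = i) := by
    intro i k hi
    constructor
    · intro h
      rw [← hσ k, eq_of_le_lastBlock hτ hi h, hσ1 i hi]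
    · rintro rfl
      rw [hσ1 k hi]
  have hfix' : ∀ i k : Fin r, (i : ℕ) < r - s → (τ i k ↔ k = i) := fun i k hi =>
    ⟨eq_of_le_lastBlock hτ hi, fun h => h ▸ τ.refl _⟩
  refine ⟨diag n (mergeNorth τ σ) * p r n r * diag n (mergeSouth τ σ),
    Submodule.subset_span ⟨_, Submodule.subset_span ⟨_, rfl, ?_⟩, _,
      Submodule.subset_span ⟨_, rfl, ?_⟩, rfl⟩, fun f h => ?_⟩
  · rintro i hi (v | v)
    · rw [Sum.inl.injEq, or_iff_left (by simp)]
      exact hfix' i v hi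
    · rw [Sum.inr.injEq, or_iff_right (by simp)]
      exact hfix i v hi
  · rintro i hi (v | v)
    · rw [Sum.inl.injEq, or_iff_left (by simp), ← hfix i v hi]
      change τ (σ i) (σ v) ↔ _
      rw [hσ1 i hi]
    · rw [Sum.inr.injEq, or_iff_right (by simp), ← hfix' i v hi]
      change τ (σ i) v ↔ _
      rw [hσ1 i hi]
  · have hp : toMatrix r n (p r n r) = cutMatrix n {last} := by
      rw [← toMatrix_p]
      congr 2
      simp only [last]
      omega
    rw [toMatrix_mul, toMatrix_mul, hp, toMatrix_diag, toMatrix_diag, Matrix.mul_apply,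
      Finset.sum_eq_single (h ∘ σ), Matrix.mul_apply, Finset.sum_eq_single (f ∘ σ)]
    · simp only [PartitionDiagram.toMatrix_apply, cutMatrix_apply, mergeNorth_le_ker_iff,
        mergeSouth_le_ker_iff, ite_zero_mul_ite_zero, mul_one, and_true]
      refine if_congr ?_ rfl rfl
      have : Set.EqOn (f ∘ σ) (h ∘ σ) {last}ᶜ ↔ Set.EqOn f h {j}ᶜ := by
        constructor
        · intro H i hi
          have := H (x := σ i) fun h' => hi ?_
          · rwa [Function.comp_apply, Function.comp_apply, hσ] at this
          · rw [Set.mem_singleton_iff] at h' ⊢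
            rw [← hσ i, h']
            exact Equiv.swap_apply_right j last
        · intro H i hi
          refine H (x := σ i) fun h' => hi ?_
          rw [Set.mem_singleton_iff] at h' ⊢
          rw [← hσ i, h']
          exact Equiv.swap_apply_left j last
      rw [this]
      tauto
    · intro g _ hg
      rw [PartitionDiagram.toMatrix_apply, if_neg, zero_mul]
      exact fun H => hg (mergeNorth_le_ker_iff.1 H).2
    · exact fun h => absurd (Finset.mem_univ _) h
    · intro g _ hg
      rw [PartitionDiagram.toMatrix_apply, if_neg, mul_zero]
      exact fun H => hg (mergeSouth_le_ker_iff.1 H).2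
    · exact fun h => absurd (Finset.mem_univ _) h

theorem exists_mem_depthIdeal_cutMatrix {j : Fin r} (hj : r - s ≤ j) :
    ∃ y ∈ depthIdeal r n s, toMatrix r n y = cutMatrix n {j} := by
  classical
  obtain ⟨y, hy, H⟩ := exists_mem_depthIdeal (n := n) (s := s) (τ := ⊥) bot_le hj
  refine ⟨y, hy, ?_⟩
  ext f h
  rw [H, cutMatrix_apply]
  exact if_congr (by rw [and_iff_right bot_le, and_iff_right bot_le]) rfl rfl

open Classical in
theorem exists_mem_depthIdeal_diagonal {τ : Setoid (Fin r)} (hτ : τ ≤ lastBlock r s) {i j : Fin r}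
    (hj : r - s ≤ j) (hne : i ≠ j) (hij : τ i j) : ∃ y ∈ depthIdeal r n s,
      toMatrix r n y = Matrix.diagonal fun f => if τ ≤ Setoid.ker f then 1 else 0 := by
  obtain ⟨y, hy, H⟩ := exists_mem_depthIdeal (n := n) hτ hj
  refine ⟨y, hy, ?_⟩
  ext f h
  rw [H, Matrix.diagonal_apply, ← ite_and]
  refine if_congr ⟨fun ⟨h1, h2, h3⟩ => ⟨funext fun k => ?_, h1⟩, ?_⟩ rfl rfl
  · by_cases hk : k = j
    · have h4 : f i = f j := h1 hij
      have h5 : h i = h j := h2 hij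
      rw [hk, ← h4, ← h5]
      exact h3 hne
    · exact h3 hk
  · rintro ⟨rfl, h1⟩
    exact ⟨h1, h1, fun _ _ => rfl⟩

open Classical in
/-- By inclusion and exclusion over the pairs in `S`, the projection to the colourings that take a
value twice on some pair comes from the ideal.  The auxiliary set-partition `τ` makes the induction
on `S` go through. -/
theorem exists_mem_depthIdeal_prod (S : Finset (Fin r × Fin r))
    (hS : ∀ q ∈ S, q.1 ≠ q.2 ∧ r - s ≤ q.1 ∧ r - s ≤ q.2) :
    ∀ τ : Setoid (Fin r), τ ≤ lastBlock r s → ∃ y ∈ depthIdeal r n s,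
      toMatrix r n y = Matrix.diagonal fun f : Fin r → Fin n =>
        (if τ ≤ Setoid.ker f then 1 else 0) * (1 - ∏ q ∈ S, if f q.1 = f q.2 then 0 else 1) := by
  induction S using Finset.induction_on with
  | empty =>
    refine fun τ _ => ⟨0, zero_mem _, ?_⟩
    simp
  | insert q S hq ih =>
    intro τ hτ
    obtain ⟨hne, h1, h2⟩ := hS q (Finset.mem_insert_self _ _)
    have ih := ih fun q' hq' => hS q' (Finset.mem_insert_of_mem hq')
    -- The set-partition whose only block with two elements is `{q.1, q.2}`.
    let π : Setoid (Fin r) := Setoid.ker fun k => if k = q.1 then q.2 else k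
    have hπq : π q.1 q.2 := by
      rw [Setoid.ker_def, if_pos rfl, if_neg hne.symm]
    have hπ : ∀ {α : Type} (f : Fin r → α), π ≤ Setoid.ker f ↔ f q.1 = f q.2 := by
      intro α f
      refine ⟨fun H => H hπq, fun H k l hkl => ?_⟩
      have hk : ∀ k, f (if k = q.1 then q.2 else k) = f k := by
        intro k
        split_ifs with h
        · rw [h, H]
        · rfl
      rw [Setoid.ker_def, ← hk k, ← hk l]
      exact congrArg f hkl
    have hτπ : τ ⊔ π ≤ lastBlock r s :=
      sup_le hτ ((hπ _).2 (by rw [if_neg (by omega), if_neg (by omega)]))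
    obtain ⟨y₁, hy₁, H₁⟩ := ih τ hτ
    obtain ⟨y₂, hy₂, H₂⟩ := exists_mem_depthIdeal_diagonal (n := n) hτπ h2 hne
      ((le_sup_right : π ≤ τ ⊔ π) hπq)
    obtain ⟨y₃, hy₃, H₃⟩ := ih (τ ⊔ π) hτπ
    refine ⟨y₁ + y₂ - y₃, sub_mem (add_mem hy₁ hy₂) hy₃, ?_⟩
    rw [map_sub, map_add, H₁, H₂, H₃, Matrix.diagonal_add, Matrix.diagonal_sub]
    congr 1
    funext f
    rw [Finset.prod_insert hq]
    simp only [sup_le_iff, hπ]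
    by_cases ha : τ ≤ Setoid.ker f <;> by_cases hb : f q.1 = f q.2 <;> simp [ha, hb]

open Classical in
/-- An element whose matrix vanishes at the southern colourings that are injective on the last `s`
strands is fixed by an element of the ideal. -/
theorem exists_mem_depthIdeal_mul_eq {X : Matrix (Fin r → Fin n) (Fin r → Fin n) ℚ}
    (hX : ∀ f h, X f h ≠ 0 → ¬ Set.InjOn h {i : Fin r | r - s ≤ i}) :
    ∃ y ∈ depthIdeal r n s, X * toMatrix r n y = X := by
  obtain ⟨y, hy, H⟩ := exists_mem_depthIdeal_prod (n := n) (s := s)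
    (Finset.univ.filter fun q : Fin r × Fin r => q.1 ≠ q.2 ∧ r - s ≤ q.1 ∧ r - s ≤ q.2)
    (fun q hq => (Finset.mem_filter.1 hq).2) ⊥ bot_le
  refine ⟨y, hy, ?_⟩
  ext f h
  rw [H, Matrix.mul_diagonal, if_pos bot_le, one_mul]
  by_cases hXfh : X f h = 0
  · rw [hXfh, zero_mul]
  · have hh := hX f h hXfh
    rw [Set.InjOn] at hh
    push Not at hh
    obtain ⟨i, hi, j, hj, hij, hne⟩ := hh
    rw [Finset.prod_eq_zero (i := (i, j))]
    · rw [sub_zero, mul_one]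
    · exact Finset.mem_filter.2 ⟨Finset.mem_univ _, hne, hi, hj⟩
    · exact if_pos hij

end PartitionAlgebra

open PartitionAlgebra KroneckerTableau in
theorem mkQ_u_mem_dvirRadical {r n s : ℕ} {lam ν : YoungDiagram} (hn : 2 * r ≤ n)
    (t : KroneckerTableau lam s ν) {y : PartitionAlgebra r n} (hy : y ∈ depthIdeal r n s)
    (h : toMatrix r n (u r n ((initial lam).comp t)) * toMatrix r n y =
      toMatrix r n (u r n ((initial lam).comp t))) :
    (skewIdeal r n s lam ν).mkQ (u r n ((initial lam).comp t)) ∈ dvirRadical r n s lam ν := by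
  refine Submodule.subset_span ⟨_, Submodule.subset_span ⟨t, rfl⟩, y, hy, ?_⟩
  rw [toMatrix_injective hn ((toMatrix_mul _ _).trans h)]

theorem mainTheorem8 (r : ℕ) : ∃ N : ℕ, ∀ n : ℕ, N ≤ n →
    ∀ (s : ℕ) (lam ν : YoungDiagram), 0 < s → lam.card + s = r →
      ∀ t : KroneckerTableau lam s ν, t.IsDR →
        (PartitionAlgebra.skewIdeal r n s lam ν).mkQ
            (KroneckerTableau.u r n ((KroneckerTableau.initial lam).comp t)) ∈
          PartitionAlgebra.dvirRadical r n s lam ν := by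
  refine ⟨2 * r, fun n hn s lam ν hs hr t ht => ?_⟩
  have hrs : r - s = lam.card := by omega
  rcases ht with ht | ⟨i, hi, ht⟩
  · obtain ⟨j, hj, h⟩ := KroneckerTableau.exists_toMatrix_u_comp_mul (n := n)
      (KroneckerTableau.initial lam) t ht hr.le
    obtain ⟨y, hy, hyj⟩ := PartitionAlgebra.exists_mem_depthIdeal_cutMatrix (n := n) (s := s)
      (hrs.le.trans hj)
    refine mkQ_u_mem_dvirRadical hn t (Submodule.smul_mem _ (n : ℚ)⁻¹ hy) ?_
    have hn0 : (n : ℚ) ≠ 0 := Nat.cast_ne_zero.2 (by omega)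
    rw [map_smul, Matrix.mul_smul, hyj, h, smul_smul, inv_mul_cancel₀ hn0, one_smul]
  · obtain ⟨i, rfl⟩ : ∃ j, i = j + 1 := ⟨i - 1, by omega⟩
    have hX : ∀ f h, PartitionAlgebra.toMatrix r n
        (KroneckerTableau.u r n ((KroneckerTableau.initial lam).comp t)) f h ≠ 0 →
          ¬ Set.InjOn h {i : Fin r | r - s ≤ i} := by
      intro f h hfh hinj
      have hcolor : Set.InjOn (color h) (Set.Ioc lam.card r) := by
        rintro v ⟨hv1, hv2⟩ w ⟨hw1, hw2⟩ hvw
        obtain ⟨a, rfl⟩ := exists_fin_of_mem (r := r) (v := v) (by omega) hv2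
        obtain ⟨b, rfl⟩ := exists_fin_of_mem (r := r) (v := w) (by omega) hw2
        rw [color_add_one, color_add_one] at hvw
        have hab : a = b := hinj (by simp only [Set.mem_ofPred_eq]; omega)
          (by simp only [Set.mem_ofPred_eq]; omega) (Fin.ext hvw)
        rw [hab]
      have hle := KroneckerTableau.freshCount_add_countP_le i (KroneckerTableau.initial lam) t hr.le
        hcolor hfh
      have hlt : lam.rowLen i < t.steps.countP fun q => q.1 = i + 1 := ht
      omega
    obtain ⟨y, hy, h⟩ := PartitionAlgebra.exists_mem_depthIdeal_mul_eq hX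
    exact mkQ_u_mem_dvirRadical hn t hy h
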